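/- All rings are commutative and unital. An $\ell$-algebra is an $\mathbb R$-algebra $A$ with a lattice order such that $a\le b$ implies $a+c\le b+c$, and such that products and nonnegative real multiples of nonnegative elements are nonnegative. It is bounded if each $a\in A$ satisfies $a\le n\cdot 1$ for some $n\in\mathbb N$, and archimedean if $na\le b$ for all $n\in\mathbb N$ implies $a\le 0$. Let $\boldsymbol{ba\ell}$ be the category of bounded archimedean $\ell$-algebras and unital $\ell$-algebra morphisms (algebra homomorphisms that are lattice homomorphisms). Write $\|a\|=\inf\{r\in\mathbb R: |a|\le r\cdot 1\}$ (read as $0$ when $A$ is the zero ring), and call $A$ uniformly complete if this norm is complete. An $\ell$-ideal is an ideal $I$ such that $|a|\le|b|$, $b\in I$ imply $a\in I$; it is archimedean if $A/I$ is archimedean. For $A\in\boldsymbol{ba\ell}$ let $F(A)$, with canonical map $f_A:A\to F(A)$, be the free object of $\boldsymbol{ba\ell}$ over the weighted set $(A,w_A)$, $w_A(a)=\max\{\|a\|,1\}$: $\|f_A(a)\|\le w_A(a)$, and each map $g:A\to B$ with $B\in\boldsymbol{ba\ell}$ and $\|g(a)\|\le w_A(a)$ for all $a$ is $\varphi\circ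 f_A$ for a unique morphism $\varphi:F(A)\to B$. Let $I^*_A$ be the least archimedean $\ell$-ideal of $F(A)$ containing, for all $a,b\in A$ and $r\in\mathbb R$, the elements $$f_A(a\wedge b)-f_A(a)\wedge f_A(b),\quad f_A(a^+)-f_A(a)^+,\quad f_A(a+r)-f_A(a)-r,\quad f_A(ra)-rf_A(a)\ \ (r\ge 0).$$ Put $H^*(A)=F(A)/I^*_A$ and let $\Box^*_a$ be the class of $f_A(a)$. For a morphism $\alpha:A\to B$, $H^*(\alpha):H^*(A)\to H^*(B)$ is the morphism with $\Box^*_a\mapsto\Box^*_{\alpha(a)}$. Thus $H^*$ is an endofunctor of $\boldsymbol{ba\ell}$. Let $V^*$ be the endofunctor of the category $\mathsf{KHaus}$ of compact Hausdorff spaces that sends $X$ to the space of its nonempty closed subsets with the Vietoris topology, and a continuous map $\varphi$ to $K\mapsto\varphi(K)$. Let $\mathsf{Alg}(H^*)$ and $\mathsf{Coalg}(V^*)$ be the categories of algebras for $H^*$ and of coalgebras for $V^*$, and let $\mathsf{Alg}^u(H^*)$ be the full subcategory of $\mathsf{Alg}(H^*)$ of those $(A,\alpha)$ with $A$ uniformly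 complete. Let $C:\mathsf{KHaus}\to\boldsymbol{ba\ell}$ be the contravariant functor $X\mapsto C(X)$ of continuous real-valued functions, and $Y:\boldsymbol{ba\ell}\to\mathsf{KHaus}$ the contravariant functor sending $A$ to the space of its maximal $\ell$-ideals, whose closed sets are the sets $\{M: I\subseteq M\}$ for $\ell$-ideals $I$, and a morphism $\alpha$ to $M\mapsto\alpha^{-1}(M)$. **Theorem.** There is a dual adjunction between $\mathsf{Alg}(H^*)$ and $\mathsf{Coalg}(V^*)$ which restricts to a dual equivalence between $\mathsf{Alg}^u(H^*)$ and $\mathsf{Coalg}(V^*)$. In detail, there are functors $\mathcal F:\mathsf{Alg}(H^*)\to\mathsf{Coalg}(V^*)^{\mathrm{op}}$ and $\mathcal G:\mathsf{Coalg}(V^*)^{\mathrm{op}}\to\mathsf{Alg}(H^*)$ that lift $Y$ and $C$ (they commute with the forgetful functors and $Y$, $C$ up to natural isomorphism), and an adjunction $\mathcal F\dashv\mathcal G$, such that every $\mathcal G(X,\sigma)$ lies in $\mathsf{Alg}^u(H^*)$, the functors $\mathcal F|_{\mathsf{Alg}^u(H^*)}$ and $\mathcal G$ form an equivalence between $\mathsf{Alg}^u(H^*)$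 and $\mathsf{Coalg}(V^*)^{\mathrm{op}}$, the unit of the adjunction is an isomorphism at every object of $\mathsf{Alg}^u(H^*)$, and the counit is an isomorphism at every object. -/

import Mathlib

open CategoryTheory
open scoped NNReal

universe u v

namespace BalDuality

/-! ### Lattice-ordered algebras -/

/-- A commutative real algebra with a lattice order is an `ℓ`-algebra if addition is monotone and
products and nonnegative real multiples of nonnegative elements are nonnegative. -/
class IsLAlgebra (A : Type*) [CommRing A] [Lattice A] [Algebra ℝ A] : Prop where
  add_le_add_right' : ∀ a b : A, a ≤ b → ∀ c, a + c ≤ b + c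
  mul_nonneg' : ∀ a b : A, 0 ≤ a → 0 ≤ b → 0 ≤ a * b
  smul_nonneg' : ∀ (r : ℝ) (a : A), 0 ≤ r → 0 ≤ a → 0 ≤ r • a

/-- An `ℓ`-ring is archimedean if `n • a ≤ b` for all natural numbers `n` implies `a ≤ 0`. -/
def IsArchimedean (A : Type*) [CommRing A] [Lattice A] : Prop :=
  ∀ a b : A, (∀ n : ℕ, n • a ≤ b) → a ≤ 0

/-- Bounded archimedean `ℓ`-algebras. -/
class IsBal (A : Type*) [CommRing A] [Lattice A] [Algebra ℝ A] : Prop extends IsLAlgebra A where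
  bounded : ∀ a : A, ∃ n : ℕ, a ≤ n • (1 : A)
  archimedean : IsArchimedean A

section LAlgebra

variable {A : Type*} [CommRing A] [Lattice A] [Algebra ℝ A] [IsLAlgebra A]

instance (priority := 100) : IsOrderedAddMonoid A where
  add_le_add_left a b h c := IsLAlgebra.add_le_add_right' a b h c

instance (priority := 100) : PosSMulMono ℝ A :=
  .of_smul_nonneg fun r hr a ha => IsLAlgebra.smul_nonneg' r a hr ha

theorem mul_nonneg_of {a b : A} (ha : 0 ≤ a) (hb : 0 ≤ b) : 0 ≤ a * b :=
  IsLAlgebra.mul_nonneg' a b ha hb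

theorem nonneg_of_add_self {y : A} (h : 0 ≤ y + y) : 0 ≤ y := by
  have h2 := smul_nonneg (show (0 : ℝ) ≤ 1 / 2 by norm_num) h
  have h3 : (1 / 2 : ℝ) • (y + y) = y := by
    rw [← two_smul ℝ y, smul_smul]; norm_num
  rwa [h3] at h2

theorem abs_mul_le (x a : A) : |x * a| ≤ |x| * |a| := by
  have e1 : 0 ≤ |x| - x := sub_nonneg.2 (le_abs_self x)
  have e2 : 0 ≤ |x| + x := by
    have := neg_le_abs x
    rw [← sub_neg_eq_add]; exact sub_nonneg.2 this
  have e3 : 0 ≤ |a| - a := sub_nonneg.2 (le_abs_self a)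
  have e4 : 0 ≤ |a| + a := by
    have := neg_le_abs a
    rw [← sub_neg_eq_add]; exact sub_nonneg.2 this
  refine abs_le'.2 ⟨?_, ?_⟩
  · refine sub_nonneg.1 (nonneg_of_add_self ?_)
    have := add_nonneg (mul_nonneg_of e1 e4) (mul_nonneg_of e2 e3)
    convert this using 1; ring
  · refine sub_nonneg.1 (nonneg_of_add_self ?_)
    have := add_nonneg (mul_nonneg_of e1 e3) (mul_nonneg_of e2 e4)
    convert this using 1; ring

theorem smul_inf_of {r : ℝ} (hr : 0 ≤ r) (x y : A) : r • (x ⊓ y) = r • x ⊓ r • y := by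
  rcases hr.eq_or_lt with rfl | hr
  · simp
  refine le_antisymm (le_inf (smul_le_smul_of_nonneg_left inf_le_left hr.le)
    (smul_le_smul_of_nonneg_left inf_le_right hr.le)) ?_
  have h : r⁻¹ • (r • x ⊓ r • y) ≤ x ⊓ y := by
    refine le_inf ?_ ?_
    · have := smul_le_smul_of_nonneg_left (inf_le_left : r • x ⊓ r • y ≤ r • x)
        (inv_nonneg.2 hr.le)
      rwa [inv_smul_smul₀ hr.ne'] at this
    · have := smul_le_smul_of_nonneg_left (inf_le_right : r • x ⊓ r • y ≤ r • y)
        (inv_nonneg.2 hr.le)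
      rwa [inv_smul_smul₀ hr.ne'] at this
  have := smul_le_smul_of_nonneg_left h hr.le
  rwa [smul_inv_smul₀ hr.ne'] at this

theorem abs_smul_of {r : ℝ} (hr : 0 ≤ r) (x : A) : |r • x| ≤ r • |x| :=
  abs_le'.2 ⟨smul_le_smul_of_nonneg_left (le_abs_self x) hr, by
    rw [← smul_neg]; exact smul_le_smul_of_nonneg_left (neg_le_abs x) hr⟩

end LAlgebra

section Bal

variable {A : Type*} [CommRing A] [Lattice A] [Algebra ℝ A] [IsBal A]

instance (priority := 100) : ZeroLEOneClass A where
  zero_le_one := by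
    obtain ⟨n, hn⟩ := IsBal.bounded |(1 : A)|
    have h0 : 0 ≤ n • (1 : A) := (abs_nonneg _).trans hn
    rcases Nat.eq_zero_or_pos n with rfl | hpos
    · have : |(1 : A)| ≤ 0 := by simpa using hn
      have h1 := (neg_le_abs (1 : A)).trans this
      simpa using h1
    · have h2 := smul_nonneg (show (0 : ℝ) ≤ (n : ℝ)⁻¹ by positivity) h0
      have hn' : (n : ℝ) ≠ 0 := by positivity
      rwa [← Nat.cast_smul_eq_nsmul ℝ, inv_smul_smul₀ hn'] at h2

theorem smul_one_mono {r s : ℝ} (h : r ≤ s) : r • (1 : A) ≤ s • 1 := by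
  rw [← sub_nonneg, ← sub_smul]
  exact smul_nonneg (sub_nonneg.2 h) zero_le_one

theorem exists_le_smul_one (a : A) : ∃ r : ℝ, 0 ≤ r ∧ a ≤ r • (1 : A) := by
  obtain ⟨n, hn⟩ := IsBal.bounded a
  exact ⟨n, n.cast_nonneg, by rwa [Nat.cast_smul_eq_nsmul ℝ]⟩

/-- The norm `‖a‖ = inf {r | |a| ≤ r · 1}`. -/
noncomputable def balNorm (a : A) : ℝ := sInf {r : ℝ | |a| ≤ r • (1 : A)}

theorem nonneg_of_abs_le [Nontrivial A] {a : A} {r : ℝ} (h : |a| ≤ r • (1 : A)) : 0 ≤ r := by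
  by_contra hr
  have h0 : 0 ≤ r • (1 : A) := (abs_nonneg a).trans h
  have h2 := smul_nonneg (inv_nonneg.2 (neg_nonneg.2 (not_le.1 hr).le)) h0
  have h3 : (-r)⁻¹ • r • (1 : A) = -1 := by
    rw [smul_smul, inv_neg, neg_mul, inv_mul_cancel₀ (not_le.1 hr).ne, neg_one_smul]
  rw [h3] at h2
  have h4 : (1 : A) ≤ 0 := by simpa using h2
  exact one_ne_zero (le_antisymm h4 zero_le_one)

theorem balNorm_nonneg (a : A) : 0 ≤ balNorm a := by
  rcases subsingleton_or_nontrivial A with h | h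
  · simp [balNorm]
  · exact Real.sInf_nonneg fun r hr => nonneg_of_abs_le hr

/-- The norm is complete: every Cauchy sequence converges. -/
def UniformlyComplete (A : Type*) [CommRing A] [Lattice A] [Algebra ℝ A] [IsBal A] : Prop :=
  ∀ s : ℕ → A, (∀ ε : ℝ, 0 < ε → ∃ N : ℕ, ∀ m ≥ N, ∀ n ≥ N, balNorm (s m - s n) < ε) →
    ∃ a : A, ∀ ε : ℝ, 0 < ε → ∃ N : ℕ, ∀ n ≥ N, balNorm (s n - a) < ε

end Bal

/-- Unital `ℓ`-algebra morphisms. -/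
@[ext]
structure BalHom (A : Type*) (B : Type*) [CommRing A] [Lattice A] [Algebra ℝ A]
    [CommRing B] [Lattice B] [Algebra ℝ B] where
  toAlgHom : A →ₐ[ℝ] B
  map_sup' : ∀ a b : A, toAlgHom (a ⊔ b) = toAlgHom a ⊔ toAlgHom b
  map_inf' : ∀ a b : A, toAlgHom (a ⊓ b) = toAlgHom a ⊓ toAlgHom b

namespace BalHom

variable {A B C : Type*} [CommRing A] [Lattice A] [Algebra ℝ A]
  [CommRing B] [Lattice B] [Algebra ℝ B] [CommRing C] [Lattice C] [Algebra ℝ C]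

instance : FunLike (BalHom A B) A B where
  coe f := f.toAlgHom
  coe_injective _ _ h := BalHom.ext (DFunLike.coe_injective h)

instance : AlgHomClass (BalHom A B) ℝ A B where
  map_mul f := map_mul f.toAlgHom
  map_one f := map_one f.toAlgHom
  map_add f := map_add f.toAlgHom
  map_zero f := map_zero f.toAlgHom
  commutes f := f.toAlgHom.commutes

instance : LatticeHomClass (BalHom A B) A B where
  map_sup f := f.map_sup'
  map_inf f := f.map_inf'

theorem hom_ext {f g : BalHom A B} (h : ∀ a, f a = g a) : f = g := DFunLike.ext _ _ h

def id (A : Type*) [CommRing A] [Lattice A] [Algebra ℝ A] : BalHom A A :=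
  ⟨AlgHom.id ℝ A, fun _ _ => rfl, fun _ _ => rfl⟩

def comp (g : BalHom B C) (f : BalHom A B) : BalHom A C where
  toAlgHom := g.toAlgHom.comp f.toAlgHom
  map_sup' a b := by
    change g (f (a ⊔ b)) = g (f a) ⊔ g (f b)
    rw [map_sup, map_sup]
  map_inf' a b := by
    change g (f (a ⊓ b)) = g (f a) ⊓ g (f b)
    rw [map_inf, map_inf]

@[simp] theorem id_apply (a : A) : BalHom.id A a = a := rfl

@[simp] theorem comp_apply (g : BalHom B C) (f : BalHom A B) (a : A) : g.comp f a = g (f a) := rfl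

theorem map_abs' (f : BalHom A B) (a : A) : f |a| = |f a| := by
  simp only [abs, map_sup, map_neg]

theorem map_mono (f : BalHom A B) {a b : A} (h : a ≤ b) : f a ≤ f b :=
  OrderHomClass.mono f h

theorem map_smul_one (f : BalHom A B) (r : ℝ) : f (r • (1 : A)) = r • (1 : B) := by
  rw [map_smul, map_one]

theorem balNorm_map_le [IsBal A] [IsBal B] (f : BalHom A B) (a : A) :
    balNorm (f a) ≤ balNorm a := by
  rcases subsingleton_or_nontrivial B with h | h
  · have h0 : balNorm (f a) = 0 := by simp [balNorm]
    rw [h0]; exact balNorm_nonneg a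
  · refine csInf_le_csInf ⟨0, fun r hr => nonneg_of_abs_le hr⟩ ?_ ?_
    · obtain ⟨r, -, hr⟩ := exists_le_smul_one |a|
      exact ⟨r, hr⟩
    · intro r hr
      have := f.map_mono (show |a| ≤ r • (1 : A) from hr)
      rwa [map_abs', map_smul_one] at this

end BalHom

/-! ### `ℓ`-ideals and the Yosida space -/

/-- An `ℓ`-ideal: an ideal `I` such that `|a| ≤ |b|` and `b ∈ I` imply `a ∈ I`. -/
@[ext]
structure LIdeal (A : Type*) [CommRing A] [Lattice A] where
  ideal : Ideal A
  solid : ∀ a b : A, |a| ≤ |b| → b ∈ ideal → a ∈ ideal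

namespace LIdeal

section Basic

variable {A : Type*} [CommRing A] [Lattice A]

instance : SetLike (LIdeal A) A where
  coe I := I.ideal
  coe_injective _ _ h := LIdeal.ext (SetLike.coe_injective h)

theorem mem_ideal {I : LIdeal A} {a : A} : a ∈ I.ideal ↔ a ∈ I := Iff.rfl

variable (I : LIdeal A)

theorem zero_mem : (0 : A) ∈ I := I.ideal.zero_mem
theorem add_mem {a b : A} (ha : a ∈ I) (hb : b ∈ I) : a + b ∈ I := I.ideal.add_mem ha hb
theorem sub_mem {a b : A} (ha : a ∈ I) (hb : b ∈ I) : a - b ∈ I := I.ideal.sub_mem ha hb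
theorem neg_mem {a : A} (ha : a ∈ I) : -a ∈ I := I.ideal.neg_mem ha
theorem mul_mem (x : A) {a : A} (ha : a ∈ I) : x * a ∈ I := I.ideal.mul_mem_left x ha

theorem smul_mem [Algebra ℝ A] (r : ℝ) {a : A} (ha : a ∈ I) : r • a ∈ I := by
  rw [Algebra.smul_def]; exact I.mul_mem _ ha

/-- The intersection of the `ℓ`-ideals with property `P` that contain `S`. -/
def genWith (P : LIdeal A → Prop) (S : Set A) : LIdeal A where
  ideal :=
    { carrier := {a | ∀ I : LIdeal A, P I → S ⊆ I → a ∈ I}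
      zero_mem' := fun I _ _ => I.zero_mem
      add_mem' := fun ha hb I hP hS => I.add_mem (ha I hP hS) (hb I hP hS)
      smul_mem' := fun x _ ha I hP hS => I.mul_mem x (ha I hP hS) }
  solid a b hab hb I hP hS := I.solid a b hab (hb I hP hS)

theorem mem_genWith {P : LIdeal A → Prop} {S : Set A} {a : A} :
    a ∈ genWith P S ↔ ∀ I : LIdeal A, P I → S ⊆ I → a ∈ I := Iff.rfl

/-- The `ℓ`-ideal generated by `S`. -/
def gen (S : Set A) : LIdeal A := genWith (fun _ => True) S

theorem subset_gen (S : Set A) : S ⊆ gen S := fun _ ha _ _ hS => hS ha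

theorem gen_subset {S : Set A} {I : LIdeal A} (h : S ⊆ I) {a : A} (ha : a ∈ gen S) : a ∈ I :=
  ha I trivial h

/-- Maximal `ℓ`-ideals: maximal among the proper `ℓ`-ideals. -/
def IsMaximal (M : LIdeal A) : Prop :=
  (∃ a : A, a ∉ M) ∧ ∀ J : LIdeal A, (M : Set A) ⊆ J → (∃ a : A, a ∉ J) → J = M

variable {I}

theorem abs_mem [AddLeftMono A] {a : A} : |a| ∈ I ↔ a ∈ I :=
  ⟨I.solid a |a| (by rw [abs_abs]), I.solid |a| a (by rw [abs_abs])⟩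

theorem mem_of_le [AddLeftMono A] {a b : A} (ha : 0 ≤ a) (h : a ≤ b) (hb : b ∈ I) : a ∈ I :=
  I.solid a b (by rw [abs_of_nonneg ha]; exact h.trans (le_abs_self b)) hb

theorem eq_univ_of_one_mem (h : (1 : A) ∈ I) (a : A) : a ∈ I := by
  simpa using I.mul_mem a h

end Basic

variable {A : Type*} [CommRing A] [Lattice A] [Algebra ℝ A] [IsBal A]

/-- In a bounded `ℓ`-algebra a solid additive subgroup is an `ℓ`-ideal. -/
def ofSolid (S : Set A) (h0 : (0 : A) ∈ S) (hadd : ∀ a ∈ S, ∀ b ∈ S, a + b ∈ S)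
    (hsol : ∀ a b : A, |a| ≤ |b| → b ∈ S → a ∈ S) : LIdeal A where
  ideal :=
    { carrier := S
      zero_mem' := h0
      add_mem' := fun ha hb => hadd _ ha _ hb
      smul_mem' := by
        intro x a ha
        obtain ⟨n, hn⟩ := IsBal.bounded |x|
        have key : ∀ n : ℕ, n • |a| ∈ S := by
          intro n
          induction n with
          | zero => simpa using h0
          | succ k ih =>
            rw [succ_nsmul]
            exact hadd _ ih _ (hsol |a| a (by rw [abs_abs]) ha)
        refine hsol _ (n • |a|) ?_ (key n)
        have h1 : |x| * |a| ≤ (n • (1 : A)) * |a| := by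
          rw [← sub_nonneg, ← sub_mul]
          exact mul_nonneg_of (sub_nonneg.2 hn) (abs_nonneg a)
        rw [smul_mul_assoc, one_mul] at h1
        exact (abs_mul_le x a).trans (h1.trans (le_abs_self _)) }
  solid := hsol

/-- The `ℓ`-ideal generated by an `ℓ`-ideal and one further element. -/
def adjoin (M : LIdeal A) (a : A) : LIdeal A :=
  ofSolid {x | ∃ m ∈ M, 0 ≤ m ∧ ∃ r : ℝ, 0 ≤ r ∧ |x| ≤ m + r • |a|}
    ⟨0, M.zero_mem, le_rfl, 0, le_rfl, by simp⟩
    (by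
      rintro x ⟨m, hm, hm0, r, hr, hx⟩ y ⟨m', hm', hm0', r', hr', hy⟩
      refine ⟨m + m', M.add_mem hm hm', add_nonneg hm0 hm0', r + r', add_nonneg hr hr', ?_⟩
      refine (abs_add_le x y).trans ((add_le_add hx hy).trans (le_of_eq ?_))
      rw [add_smul]; abel)
    (by
      rintro x y hxy ⟨m, hm, hm0, r, hr, hy⟩
      exact ⟨m, hm, hm0, r, hr, hxy.trans hy⟩)

theorem one_notMem {M : LIdeal A} (hM : M.IsMaximal) : (1 : A) ∉ M := fun h => by
  obtain ⟨a, ha⟩ := hM.1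
  exact ha (eq_univ_of_one_mem h a)

theorem exists_of_notMem {M : LIdeal A} (hM : M.IsMaximal) {a : A} (ha : a ∉ M) :
    ∃ m ∈ M, 0 ≤ m ∧ ∃ r : ℝ, 0 ≤ r ∧ 1 ≤ m + r • |a| := by
  by_contra hcon
  have h1 : (1 : A) ∉ adjoin M a := by
    rintro ⟨m, hm, hm0, r, hr, h⟩
    exact hcon ⟨m, hm, hm0, r, hr, (le_abs_self 1).trans h⟩
  have hJ : adjoin M a = M := by
    refine hM.2 _ (fun m hm => ?_) ⟨1, h1⟩
    exact ⟨|m|, abs_mem.2 hm, abs_nonneg m, 0, le_rfl, by simp⟩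
  refine ha (hJ ▸ ?_)
  exact ⟨0, M.zero_mem, le_rfl, 1, zero_le_one, by simp⟩

theorem inf_notMem {M : LIdeal A} (hM : M.IsMaximal) {x y : A} (hx0 : 0 ≤ x) (hy0 : 0 ≤ y)
    (hx : x ∉ M) (hy : y ∉ M) : x ⊓ y ∉ M := by
  intro hxy
  obtain ⟨m, hm, hm0, r, hr, h⟩ := exists_of_notMem hM hx
  obtain ⟨m', hm', hm0', r', hr', h'⟩ := exists_of_notMem hM hy
  rw [abs_of_nonneg hx0] at h
  rw [abs_of_nonneg hy0] at h'
  have e1 : (1 : A) ≤ (m + m') + (r + r') • x := by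
    refine h.trans (add_le_add (le_add_of_nonneg_right hm0') ?_)
    rw [add_smul]; exact le_add_of_nonneg_right (smul_nonneg hr' hx0)
  have e2 : (1 : A) ≤ (m + m') + (r + r') • y := by
    refine h'.trans (add_le_add (le_add_of_nonneg_left hm0) ?_)
    rw [add_smul]; exact le_add_of_nonneg_left (smul_nonneg hr hy0)
  have e3 : (1 : A) ≤ (m + m') + (r + r') • (x ⊓ y) := by
    rw [smul_inf_of (add_nonneg hr hr'), add_inf]
    exact le_inf e1 e2
  exact one_notMem hM (mem_of_le zero_le_one e3
    (M.add_mem (M.add_mem hm hm') (M.smul_mem _ hxy)))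

theorem posPart_inf_negPart (a : A) : (a ⊔ 0) ⊓ (-a ⊔ 0) = 0 := posPart_inf_negPart_eq_zero a

theorem pos_or_neg_mem {M : LIdeal A} (hM : M.IsMaximal) (a : A) :
    a ⊔ 0 ∈ M ∨ -a ⊔ 0 ∈ M := by
  by_contra hcon
  rw [not_or] at hcon
  refine inf_notMem hM le_sup_right le_sup_right hcon.1 hcon.2 ?_
  rw [posPart_inf_negPart]; exact M.zero_mem

theorem smul_one_mem {M : LIdeal A} (hM : M.IsMaximal) {r : ℝ} (h : r • (1 : A) ∈ M) : r = 0 := by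
  by_contra hr
  have := M.smul_mem r⁻¹ h
  rw [inv_smul_smul₀ hr] at this
  exact one_notMem hM this

theorem pos_sub_mem_of_le {M : LIdeal A} {a : A} {r s : ℝ} (hrs : r ≤ s)
    (h : (a - r • (1 : A)) ⊔ 0 ∈ M) : (a - s • (1 : A)) ⊔ 0 ∈ M :=
  mem_of_le le_sup_right (sup_le_sup_right (sub_le_sub_left (smul_one_mono hrs) a) 0) h

theorem abs_le_of_mem {M : LIdeal A} (hM : M.IsMaximal) {m : A} (hm : m ∈ M) {r : ℝ}
    (h : r • (1 : A) ≤ m) : r ≤ 0 := by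
  by_contra hr
  have hr' := (not_le.1 hr).le
  have : r • (1 : A) ∈ M := mem_of_le (smul_nonneg hr' zero_le_one) h hm
  exact hr (smul_one_mem hM this).le

theorem exists_value {M : LIdeal A} (hM : M.IsMaximal) (a : A) : ∃ r : ℝ, a - r • (1 : A) ∈ M := by
  set T : Set ℝ := {r | (a - r • (1 : A)) ⊔ 0 ∈ M} with hT
  have hne : T.Nonempty := by
    obtain ⟨r, -, hr⟩ := exists_le_smul_one a
    refine ⟨r, ?_⟩
    change (a - r • (1 : A)) ⊔ 0 ∈ M
    rw [sup_eq_right.2 (sub_nonpos.2 hr)]; exact M.zero_mem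
  have hbdd : BddBelow T := by
    obtain ⟨r, -, hr⟩ := exists_le_smul_one (-a)
    refine ⟨-r, fun s hs => ?_⟩
    have h1 : (-r - s) • (1 : A) ≤ (a - s • (1 : A)) ⊔ 0 := by
      refine le_trans ?_ le_sup_left
      rw [sub_smul, neg_smul]
      exact sub_le_sub_right (neg_le.1 hr) _
    have := abs_le_of_mem hM hs h1
    linarith
  refine ⟨sInf T, ?_⟩
  by_contra hcon
  obtain ⟨m, hm, hm0, r, hr, h⟩ := exists_of_notMem hM hcon
  set s := sInf T
  set ε : ℝ := 1 / (2 * (r + 1)) with hε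
  have hεpos : 0 < ε := by positivity
  obtain ⟨t, htT, hts⟩ := exists_lt_of_csInf_lt hne (show sInf T < s + ε by linarith)
  have h1 : (a - (s + ε) • (1 : A)) ⊔ 0 ∈ M := pos_sub_mem_of_le hts.le htT
  have h2 : -(a - (s - ε) • (1 : A)) ⊔ 0 ∈ M := by
    rcases pos_or_neg_mem hM (a - (s - ε) • (1 : A)) with h2 | h2
    · have := csInf_le hbdd (show s - ε ∈ T from h2)
      exact absurd this (by linarith)
    · exact h2
  set p := (a - (s + ε) • (1 : A)) ⊔ 0
  set q := -(a - (s - ε) • (1 : A)) ⊔ 0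
  have hp0 : 0 ≤ p := le_sup_right
  have hq0 : 0 ≤ q := le_sup_right
  have hp : a - (s + ε) • (1 : A) ≤ p := le_sup_left
  have hq : -(a - (s - ε) • (1 : A)) ≤ q := le_sup_left
  have habs : |a - s • (1 : A)| ≤ p + q + ε • (1 : A) := by
    refine abs_le'.2 ⟨?_, ?_⟩
    · have e : a - s • (1 : A) = (a - (s + ε) • (1 : A)) + 0 + ε • (1 : A) := by
        rw [add_smul]; abel
      rw [e]; exact add_le_add_left (add_le_add hp hq0) _
    · have e : -(a - s • (1 : A)) = 0 + -(a - (s - ε) • (1 : A)) + ε • (1 : A) := by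
        rw [sub_smul]; abel
      rw [e]; exact add_le_add_left (add_le_add hp0 hq) _
  have h3 : (1 : A) ≤ m + r • (p + q + ε • (1 : A)) :=
    h.trans (add_le_add_right (smul_le_smul_of_nonneg_left habs hr) _)
  have h4 : (1 - r * ε) • (1 : A) ≤ m + r • (p + q) := by
    rw [sub_smul, one_smul, sub_le_iff_le_add, mul_smul, add_assoc, ← smul_add]
    exact h3
  have h5 := abs_le_of_mem hM (M.add_mem hm (M.smul_mem r (M.add_mem h1 h2))) h4
  have h6 : r * ε < 1 := by
    rw [hε, mul_one_div, div_lt_one (by positivity)]; linarith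
  linarith

theorem value_unique {M : LIdeal A} (hM : M.IsMaximal) {a : A} {r s : ℝ}
    (hr : a - r • (1 : A) ∈ M) (hs : a - s • (1 : A) ∈ M) : r = s := by
  have := M.sub_mem hs hr
  have e : a - s • (1 : A) - (a - r • (1 : A)) = (r - s) • (1 : A) := by rw [sub_smul]; abel
  rw [e] at this
  exact sub_eq_zero.1 (smul_one_mem hM this)

/-- Every proper `ℓ`-ideal is contained in a maximal one. -/
theorem exists_maximal (I : LIdeal A) (hI : (1 : A) ∉ I) :
    ∃ M : LIdeal A, M.IsMaximal ∧ (I : Set A) ⊆ M := by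
  obtain ⟨m, hIm, hm⟩ := zorn_subset_nonempty
    {S : Set A | ∃ J : LIdeal A, (J : Set A) = S ∧ (1 : A) ∉ J} (by
      intro c hc hchain hne
      obtain ⟨S₀, hS₀⟩ := hne
      have hdir : ∀ S ∈ c, ∀ T ∈ c, ∃ U ∈ c, S ⊆ U ∧ T ⊆ U := by
        intro S hS T hT
        rcases hchain.total hS hT with h | h
        · exact ⟨T, hT, h, subset_rfl⟩
        · exact ⟨S, hS, subset_rfl, h⟩
      refine ⟨⋃₀ c, ⟨ofSolid (⋃₀ c) ?_ ?_ ?_, rfl, ?_⟩, fun s hs => Set.subset_sUnion_of_mem hs⟩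
      · obtain ⟨J, hJ, -⟩ := hc hS₀
        exact ⟨S₀, hS₀, hJ ▸ J.zero_mem⟩
      · rintro a ⟨S, hS, haS⟩ b ⟨T, hT, hbT⟩
        obtain ⟨U, hU, hSU, hTU⟩ := hdir S hS T hT
        obtain ⟨J, hJ, -⟩ := hc hU
        have h1 : a ∈ (J : Set A) := hJ ▸ hSU haS
        have h2 : b ∈ (J : Set A) := hJ ▸ hTU hbT
        exact ⟨U, hU, hJ ▸ J.add_mem h1 h2⟩
      · rintro a b hab ⟨S, hS, hbS⟩
        obtain ⟨J, hJ, -⟩ := hc hS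
        have h1 : b ∈ (J : Set A) := hJ ▸ hbS
        exact ⟨S, hS, hJ ▸ J.solid a b hab h1⟩
      · rintro ⟨S, hS, h1⟩
        obtain ⟨J, hJ, hJ1⟩ := hc hS
        exact hJ1 (show (1 : A) ∈ (J : Set A) from hJ ▸ h1)) (I : Set A) ⟨I, rfl, hI⟩
  obtain ⟨⟨M, rfl, hM1⟩, hmax⟩ := hm
  refine ⟨M, ⟨⟨1, hM1⟩, fun J hMJ hJ => ?_⟩, hIm⟩
  obtain ⟨a, ha⟩ := hJ
  have := hmax (y := (J : Set A)) ⟨J, rfl, fun h1 => ha (eq_univ_of_one_mem h1 a)⟩ hMJ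
  exact SetLike.coe_injective (Set.Subset.antisymm this hMJ)

/-- An element outside zero is outside some maximal `ℓ`-ideal. -/
theorem exists_notMem_of_ne_zero {a : A} (ha : a ≠ 0) : ∃ M : LIdeal A, M.IsMaximal ∧ a ∉ M := by
  have h1 : ∃ n : ℕ, ¬ n • |a| ≤ 1 := by
    by_contra hcon
    push Not at hcon
    have := IsBal.archimedean (A := A) |a| 1 hcon
    exact ha (by
      have h0 : |a| = 0 := le_antisymm this (abs_nonneg a)
      refine le_antisymm ((le_abs_self a).trans h0.le) ?_
      have := (neg_le_abs a).trans h0.le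
      simpa using this)
  obtain ⟨n, hn⟩ := h1
  set b : A := n • |a| - 1 with hb
  have hbpos : b ⊔ 0 ≠ 0 := fun h => hn (sub_nonpos.1 (sup_eq_right.1 h))
  set J : LIdeal A := ofSolid {x | ∃ r : ℝ, 0 ≤ r ∧ |x| ≤ r • (-b ⊔ 0)}
    ⟨0, le_rfl, by simp⟩
    (by
      rintro x ⟨r, hr, hx⟩ y ⟨s, hs, hy⟩
      exact ⟨r + s, add_nonneg hr hs, (abs_add_le x y).trans
        ((add_le_add hx hy).trans (add_smul r s _).ge)⟩)
    (by
      rintro x y hxy ⟨r, hr, hy⟩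
      exact ⟨r, hr, hxy.trans hy⟩) with hJ
  have hJ1 : (1 : A) ∉ J := by
    rintro ⟨r, hr, h⟩
    have h1 : (1 : A) ≤ r • (-b ⊔ 0) := (le_abs_self 1).trans h
    obtain ⟨s, hs, hbs⟩ := exists_le_smul_one (b ⊔ 0)
    have hz : (b ⊔ 0) ⊓ (-b ⊔ 0) = 0 := posPart_inf_negPart b
    have hnn : 0 ≤ -b ⊔ 0 := le_sup_right
    have hpp : 0 ≤ b ⊔ 0 := le_sup_right
    have h2 : b ⊔ 0 ≤ (1 + s * r) • ((b ⊔ 0) ⊓ (-b ⊔ 0)) := by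
      rw [smul_inf_of (by positivity)]
      refine le_inf ?_ ?_
      · rw [add_smul, one_smul]
        exact le_add_of_nonneg_right (smul_nonneg (mul_nonneg hs hr) hpp)
      · rw [add_smul, one_smul, mul_smul]
        exact (hbs.trans (smul_le_smul_of_nonneg_left h1 hs)).trans (le_add_of_nonneg_left hnn)
    rw [hz, smul_zero] at h2
    exact hbpos (le_antisymm h2 hpp)
  obtain ⟨M, hM, hJM⟩ := exists_maximal J hJ1
  refine ⟨M, hM, fun haM => ?_⟩
  have hneg : -b ⊔ 0 ∈ M := hJM ⟨1, zero_le_one, by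
    rw [one_smul, abs_of_nonneg (le_sup_right : (0 : A) ≤ -b ⊔ 0)]⟩
  have h3 : (1 : A) ≤ n • |a| + (-b ⊔ 0) := by
    have : -b ≤ -b ⊔ 0 := le_sup_left
    have e : (1 : A) = n • |a| + -b := by rw [hb]; abel
    calc (1 : A) = n • |a| + -b := e
      _ ≤ _ := add_le_add_right this _
  refine one_notMem hM (mem_of_le zero_le_one h3 (M.add_mem ?_ hneg))
  rw [nsmul_eq_mul]
  exact M.mul_mem _ (abs_mem.2 haM)

end LIdeal

/-- The Yosida space of `A`: the set of maximal `ℓ`-ideals of `A`. -/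
def YosidaSpace (A : Type u) [CommRing A] [Lattice A] : Type u :=
  {M : LIdeal A // M.IsMaximal}

namespace YosidaSpace

section

variable {A : Type*} [CommRing A] [Lattice A] [Algebra ℝ A] [IsBal A]

/-- The set `Z_ℓ(I)` of maximal `ℓ`-ideals containing `I`. -/
def zeroLocus (I : LIdeal A) : Set (YosidaSpace A) := {M | (I : Set A) ⊆ M.1}

theorem iInter_zeroLocus {ι : Type*} (I : ι → LIdeal A) :
    ⋂ i, zeroLocus (I i) = zeroLocus (LIdeal.gen (⋃ i, (I i : Set A))) := by
  ext M
  simp only [Set.mem_iInter]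
  constructor
  · intro h a ha
    exact LIdeal.gen_subset (Set.iUnion_subset h) ha
  · intro h i a ha
    exact h (LIdeal.subset_gen _ (Set.mem_iUnion.2 ⟨i, ha⟩))

theorem union_zeroLocus (I J : LIdeal A) : ∃ K : LIdeal A,
    zeroLocus I ∪ zeroLocus J = zeroLocus K := by
  refine ⟨LIdeal.ofSolid ((I : Set A) ∩ J) ⟨I.zero_mem, J.zero_mem⟩
    (fun a ha b hb => ⟨I.add_mem ha.1 hb.1, J.add_mem ha.2 hb.2⟩)
    (fun a b hab hb => ⟨I.solid a b hab hb.1, J.solid a b hab hb.2⟩), ?_⟩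
  ext M
  constructor
  · rintro (h | h) a ⟨haI, haJ⟩
    · exact h haI
    · exact h haJ
  · intro h
    by_contra hcon
    simp only [Set.mem_union, not_or] at hcon
    obtain ⟨a, haI, haM⟩ := Set.not_subset.1 hcon.1
    obtain ⟨b, hbJ, hbM⟩ := Set.not_subset.1 hcon.2
    refine LIdeal.inf_notMem M.2 (abs_nonneg a) (abs_nonneg b)
      (fun h => haM (LIdeal.abs_mem.1 h)) (fun h => hbM (LIdeal.abs_mem.1 h)) (h ⟨?_, ?_⟩)
    · exact LIdeal.mem_of_le (le_inf (abs_nonneg a) (abs_nonneg b)) inf_le_left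
        (LIdeal.abs_mem.2 haI)
    · exact LIdeal.mem_of_le (le_inf (abs_nonneg a) (abs_nonneg b)) inf_le_right
        (LIdeal.abs_mem.2 hbJ)

/-- The topology on the Yosida space: the closed sets are exactly the sets `Z_ℓ(I)`. -/
instance : TopologicalSpace (YosidaSpace A) :=
  TopologicalSpace.ofClosed (Set.range zeroLocus)
    ⟨LIdeal.gen {1}, Set.eq_empty_of_forall_notMem fun M h =>
      LIdeal.one_notMem M.2 (h (LIdeal.subset_gen _ rfl))⟩
    (by
      intro S hS
      refine ⟨LIdeal.gen (⋃ I : {I : LIdeal A // zeroLocus I ∈ S}, (I.1 : Set A)), ?_⟩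
      rw [← iInter_zeroLocus]
      ext M
      simp only [Set.mem_iInter, Set.mem_sInter, Subtype.forall]
      constructor
      · intro h t ht
        obtain ⟨I, rfl⟩ := hS ht
        exact h I ht
      · exact fun h I hI => h _ hI)
    (by
      rintro _ ⟨I, rfl⟩ _ ⟨J, rfl⟩
      obtain ⟨K, hK⟩ := union_zeroLocus I J
      exact ⟨K, hK.symm⟩)

theorem isClosed_iff {s : Set (YosidaSpace A)} : IsClosed s ↔ ∃ I : LIdeal A, zeroLocus I = s := by
  rw [← isOpen_compl_iff]
  change sᶜᶜ ∈ Set.range zeroLocus ↔ _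
  rw [compl_compl]; rfl

theorem isClosed_zero (a : A) : IsClosed {M : YosidaSpace A | a ∈ M.1} :=
  isClosed_iff.2 ⟨LIdeal.gen {a}, by
    ext M
    exact ⟨fun h => h (LIdeal.subset_gen _ rfl), fun h _ hb =>
      LIdeal.gen_subset (Set.singleton_subset_iff.2 h) hb⟩⟩

instance : CompactSpace (YosidaSpace A) := by
  refine compactSpace_of_finite_subfamily_closed fun {ι} t ht hempty => ?_
  choose I hI using fun i => isClosed_iff.1 (ht i)
  obtain rfl : (fun i => zeroLocus (I i)) = t := funext hI
  let J : LIdeal A := LIdeal.ofSolid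
    {x | ∃ s : Finset ι, x ∈ LIdeal.gen (⋃ i ∈ s, (I i : Set A))}
    ⟨∅, LIdeal.zero_mem _⟩
    (by
      classical
      rintro a ⟨s, ha⟩ b ⟨s', hb⟩
      refine ⟨s ∪ s', LIdeal.add_mem _ (LIdeal.gen_subset ?_ ha) (LIdeal.gen_subset ?_ hb)⟩
      · refine Set.Subset.trans ?_ (LIdeal.subset_gen _)
        exact Set.biUnion_subset_biUnion_left fun i hi => Finset.mem_union_left _ hi
      · refine Set.Subset.trans ?_ (LIdeal.subset_gen _)
        exact Set.biUnion_subset_biUnion_left fun i hi => Finset.mem_union_right _ hi)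
    (by
      rintro a b hab ⟨s, hb⟩
      exact ⟨s, LIdeal.solid _ a b hab hb⟩)
  have h1 : (1 : A) ∈ J := by
    by_contra h1
    obtain ⟨M, hM, hJM⟩ := LIdeal.exists_maximal J h1
    have : (⟨M, hM⟩ : YosidaSpace A) ∈ ⋂ i, zeroLocus (I i) := by
      refine Set.mem_iInter.2 fun i a ha => hJM ⟨{i}, LIdeal.subset_gen _ ?_⟩
      simpa using ha
    rw [hempty] at this
    exact this
  obtain ⟨s, hs⟩ := h1
  refine ⟨s, Set.eq_empty_of_forall_notMem fun M hM => LIdeal.one_notMem M.2 ?_⟩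
  refine LIdeal.gen_subset (Set.iUnion₂_subset fun i hi => ?_) hs
  exact Set.mem_iInter₂.1 hM i hi

theorem exists_separating {M N : YosidaSpace A} (h : M ≠ N) : ∃ a ∈ M.1, a ∉ N.1 := by
  by_contra hcon
  push Not at hcon
  exact h (Subtype.ext (M.2.2 N.1 hcon N.2.1).symm)

instance : T2Space (YosidaSpace A) := by
  refine ⟨fun M N hMN => ?_⟩
  obtain ⟨a, haM, haN⟩ := exists_separating hMN
  have haN' : |a| ∉ N.1 := fun h => haN (LIdeal.abs_mem.1 h)
  obtain ⟨m, hm, hm0, r, hr, h⟩ := LIdeal.exists_of_notMem N.2 haN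
  set b : A := (2 * r) • |a| - 1 with hb
  refine ⟨{P | -b ⊔ 0 ∈ P.1}ᶜ, {P | b ⊔ 0 ∈ P.1}ᶜ, (isClosed_zero _).isOpen_compl,
    (isClosed_zero _).isOpen_compl, ?_, ?_, ?_⟩
  · intro hP
    have e : (1 : A) ≤ (2 * r) • |a| + (-b ⊔ 0) := by
      calc (1 : A) = (2 * r) • |a| + -b := by rw [hb]; abel
        _ ≤ _ := add_le_add_right le_sup_left _
    exact LIdeal.one_notMem M.2 (LIdeal.mem_of_le zero_le_one e
      (M.1.add_mem (M.1.smul_mem _ (LIdeal.abs_mem.2 haM)) hP))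
  · intro hP
    have e : (1 : A) ≤ (2 : ℝ) • m + (b ⊔ 0) := by
      have h2 := smul_le_smul_of_nonneg_left h (show (0 : ℝ) ≤ 2 by norm_num)
      rw [smul_add, smul_smul, two_smul ℝ (1 : A), ← sub_le_sub_iff_right (1 : A),
        add_sub_cancel_right, add_sub_assoc, ← hb] at h2
      exact h2.trans (add_le_add_right le_sup_left _)
    exact LIdeal.one_notMem N.2 (LIdeal.mem_of_le zero_le_one e
      (N.1.add_mem (N.1.smul_mem _ hm) hP))
  · rw [Set.disjoint_left]
    intro P h1 h2
    rcases LIdeal.pos_or_neg_mem P.2 b with h | h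
    · exact h2 h
    · exact h1 h

/-- The unique real number `r` with `a + M = r + M`. -/
noncomputable def value (M : YosidaSpace A) (a : A) : ℝ := (LIdeal.exists_value M.2 a).choose

theorem sub_value_mem (M : YosidaSpace A) (a : A) : a - M.value a • (1 : A) ∈ M.1 :=
  (LIdeal.exists_value M.2 a).choose_spec

theorem value_eq {M : YosidaSpace A} {a : A} {r : ℝ} (h : a - r • (1 : A) ∈ M.1) :
    M.value a = r :=
  LIdeal.value_unique M.2 (M.sub_value_mem a) h

theorem value_eq_zero {M : YosidaSpace A} {a : A} : M.value a = 0 ↔ a ∈ M.1 :=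
  ⟨fun h => by simpa [h] using M.sub_value_mem a, fun h => value_eq (by simpa using h)⟩

theorem value_add (M : YosidaSpace A) (a b : A) : M.value (a + b) = M.value a + M.value b := by
  refine value_eq ?_
  have := M.1.add_mem (M.sub_value_mem a) (M.sub_value_mem b)
  convert this using 1
  rw [add_smul]; abel

theorem value_mul (M : YosidaSpace A) (a b : A) : M.value (a * b) = M.value a * M.value b := by
  refine value_eq ?_
  have := M.1.add_mem (M.1.mul_mem b (M.sub_value_mem a))
    (M.1.smul_mem (M.value a) (M.sub_value_mem b))
  convert this using 1
  rw [smul_sub, smul_smul, mul_sub, mul_smul_comm, mul_one, mul_comm b a]; abel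

theorem value_smul_one (M : YosidaSpace A) (r : ℝ) : M.value (r • (1 : A)) = r :=
  value_eq (by rw [sub_self]; exact M.1.zero_mem)

theorem value_neg (M : YosidaSpace A) (a : A) : M.value (-a) = -M.value a := by
  have := M.value_add (-a) a
  rw [neg_add_cancel, value_eq_zero.2 M.1.zero_mem] at this
  linarith

theorem value_nonneg (M : YosidaSpace A) {a : A} (ha : 0 ≤ a) : 0 ≤ M.value a := by
  by_contra hneg
  have h2 : (-M.value a) • (1 : A) ≤ a - M.value a • (1 : A) := by
    rw [neg_smul, sub_eq_add_neg]; exact le_add_of_nonneg_left ha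
  have := LIdeal.abs_le_of_mem M.2 (M.sub_value_mem a) h2
  linarith

theorem value_mono (M : YosidaSpace A) {a b : A} (h : a ≤ b) : M.value a ≤ M.value b := by
  have := M.value_nonneg (sub_nonneg.2 h)
  rw [sub_eq_add_neg, value_add, value_neg] at this
  linarith

theorem value_pos (M : YosidaSpace A) (a : A) : M.value (a ⊔ 0) = M.value a ⊔ 0 := by
  have e : a = (a ⊔ 0) + -(-a ⊔ 0) := by
    rw [← sub_eq_add_neg]; exact (posPart_sub_negPart a).symm
  have h1 := M.value_nonneg (le_sup_right : (0 : A) ≤ a ⊔ 0)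
  have h2 := M.value_nonneg (le_sup_right : (0 : A) ≤ -a ⊔ 0)
  have h3 : M.value a = M.value (a ⊔ 0) - M.value (-a ⊔ 0) := by
    conv_lhs => rw [e, value_add, value_neg, ← sub_eq_add_neg]
  rcases LIdeal.pos_or_neg_mem M.2 a with h | h
  · rw [value_eq_zero.2 h] at h3 ⊢
    rw [sup_eq_right.2]; linarith
  · rw [value_eq_zero.2 h, sub_zero] at h3
    rw [h3]; exact (sup_eq_left.2 h1).symm

theorem value_sup (M : YosidaSpace A) (a b : A) : M.value (a ⊔ b) = M.value a ⊔ M.value b := by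
  have e : a ⊔ b = ((a + -b) ⊔ 0) + b := by rw [sup_add]; simp
  rw [e, value_add, value_pos, value_add, value_neg, max_add]
  simp

theorem value_inf (M : YosidaSpace A) (a b : A) : M.value (a ⊓ b) = M.value a ⊓ M.value b := by
  have e : a ⊓ b = -(-a ⊔ -b) := by rw [neg_sup, neg_neg, neg_neg]
  rw [e, value_neg, value_sup, value_neg, value_neg, neg_sup, neg_neg, neg_neg]

theorem abs_value_le (M : YosidaSpace A) (a : A) : |M.value a| ≤ balNorm a := by
  obtain ⟨r, -, hr⟩ := exists_le_smul_one |a|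
  refine le_csInf ⟨r, hr⟩ fun s hs => ?_
  have h1 := M.value_mono ((le_abs_self a).trans hs)
  have h2 := M.value_mono ((neg_le_abs a).trans hs)
  rw [value_smul_one] at h1 h2
  rw [value_neg] at h2
  exact abs_le'.2 ⟨h1, h2⟩

theorem ext_of_value {a b : A} (h : ∀ M : YosidaSpace A, M.value a = M.value b) : a = b := by
  by_contra hab
  obtain ⟨M, hM, hnot⟩ := LIdeal.exists_notMem_of_ne_zero (sub_ne_zero.2 hab)
  obtain ⟨N, hN⟩ : ∃ N : YosidaSpace A, N.1 = M := ⟨⟨M, hM⟩, rfl⟩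
  subst hN
  refine hnot (value_eq_zero.1 ?_)
  rw [sub_eq_add_neg, value_add, value_neg, h]
  exact add_neg_cancel _

end

section Map

variable {A B : Type*} [CommRing A] [Lattice A] [Algebra ℝ A] [IsBal A]
  [CommRing B] [Lattice B] [Algebra ℝ B] [IsBal B]

/-- The preimage of an `ℓ`-ideal under a morphism. -/
def comapIdeal (f : BalHom A B) (I : LIdeal B) : LIdeal A where
  ideal := I.ideal.comap f.toAlgHom
  solid a b hab hb := by
    refine I.solid (f a) (f b) ?_ hb
    rw [← f.map_abs', ← f.map_abs']; exact f.map_mono hab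

theorem mem_comapIdeal {f : BalHom A B} {I : LIdeal B} {a : A} : a ∈ comapIdeal f I ↔ f a ∈ I :=
  Iff.rfl

theorem comapIdeal_isMaximal (f : BalHom A B) {M : LIdeal B} (hM : M.IsMaximal) :
    (comapIdeal f M).IsMaximal := by
  refine ⟨⟨1, fun h => LIdeal.one_notMem hM ?_⟩, fun J hJ hJ1 => ?_⟩
  · have : f 1 ∈ M := h
    rwa [map_one] at this
  · refine SetLike.coe_injective (Set.Subset.antisymm (fun a ha => ?_) hJ)
    obtain ⟨r, hr⟩ := LIdeal.exists_value hM (f a)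
    have h1 : a - r • (1 : A) ∈ comapIdeal f M := by
      rw [mem_comapIdeal, map_sub, f.map_smul_one]; exact hr
    have h2 : r • (1 : A) ∈ J := by
      have := J.sub_mem ha (hJ h1)
      rwa [sub_sub_cancel] at this
    obtain rfl : r = 0 := by
      by_contra h0
      obtain ⟨x, hx⟩ := hJ1
      have h3 := J.smul_mem r⁻¹ h2
      rw [inv_smul_smul₀ h0] at h3
      exact hx (LIdeal.eq_univ_of_one_mem h3 x)
    simpa using h1

/-- The continuous map `M ↦ f⁻¹(M)` between Yosida spaces. -/
def map (f : BalHom A B) : C(YosidaSpace B, YosidaSpace A) where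
  toFun M := ⟨comapIdeal f M.1, comapIdeal_isMaximal f M.2⟩
  continuous_toFun := by
    refine continuous_iff_isClosed.2 fun s hs => ?_
    obtain ⟨I, rfl⟩ := isClosed_iff.1 hs
    refine isClosed_iff.2 ⟨LIdeal.gen (f '' I), ?_⟩
    ext M
    constructor
    · intro h a ha
      exact h (LIdeal.subset_gen _ ⟨a, ha, rfl⟩)
    · intro h b hb
      refine LIdeal.gen_subset ?_ hb
      rintro _ ⟨a, ha, rfl⟩
      exact h ha

end Map

end YosidaSpace


/-! ### Quotients by `ℓ`-ideals -/

namespace LIdeal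

section Quotient

variable {A : Type*} [CommRing A] [Lattice A]

/-- The quotient ring `A / I`. -/
def Quot (I : LIdeal A) : Type _ := A ⧸ I.ideal

instance (I : LIdeal A) : CommRing I.Quot := inferInstanceAs (CommRing (A ⧸ I.ideal))

instance [Algebra ℝ A] (I : LIdeal A) : Algebra ℝ I.Quot :=
  inferInstanceAs (Algebra ℝ (A ⧸ I.ideal))

/-- The quotient map `A → A / I`. -/
def proj (I : LIdeal A) : A →+* I.Quot := Ideal.Quotient.mk I.ideal

theorem mk_surjective (I : LIdeal A) : Function.Surjective I.proj := Ideal.Quotient.mk_surjective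

theorem mk_eq_mk {I : LIdeal A} {a b : A} : I.proj a = I.proj b ↔ a - b ∈ I :=
  Ideal.Quotient.mk_eq_mk_iff_sub_mem a b

theorem mk_eq_zero {I : LIdeal A} {a : A} : I.proj a = 0 ↔ a ∈ I :=
  Ideal.Quotient.eq_zero_iff_mem

theorem mk_smul [Algebra ℝ A] (I : LIdeal A) (r : ℝ) (a : A) : I.proj (r • a) = r • I.proj a := rfl

variable [Algebra ℝ A] [IsLAlgebra A]

theorem sup_sub_sup_mem (I : LIdeal A) {a a' b b' : A} (h : a - a' ∈ I) (h' : b - b' ∈ I) :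
    a ⊔ b - a' ⊔ b' ∈ I := by
  have h1 : a ⊔ b - a' ⊔ b ∈ I := I.solid _ _ (abs_sup_sub_sup_le_abs a a' b) h
  have h2 : a' ⊔ b - a' ⊔ b' ∈ I := by
    rw [sup_comm a' b, sup_comm a' b']
    exact I.solid _ _ (abs_sup_sub_sup_le_abs b b' a') h'
  have := I.add_mem h1 h2
  rwa [sub_add_sub_cancel] at this

theorem inf_sub_inf_mem (I : LIdeal A) {a a' b b' : A} (h : a - a' ∈ I) (h' : b - b' ∈ I) :
    a ⊓ b - a' ⊓ b' ∈ I := by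
  have h1 : a ⊓ b - a' ⊓ b ∈ I := I.solid _ _ (abs_inf_sub_inf_le_abs a a' b) h
  have h2 : a' ⊓ b - a' ⊓ b' ∈ I := by
    rw [inf_comm a' b, inf_comm a' b']
    exact I.solid _ _ (abs_inf_sub_inf_le_abs b b' a') h'
  have := I.add_mem h1 h2
  rwa [sub_add_sub_cancel] at this

/-- The lattice operations of `A / I` are those induced by the lattice operations of `A`. -/
instance (I : LIdeal A) : Lattice I.Quot :=
  letI : Max I.Quot := ⟨fun x y => Quotient.liftOn₂' x y (fun a b => I.proj (a ⊔ b))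
    (fun _ _ _ _ h h' => mk_eq_mk.2 (I.sup_sub_sup_mem
      ((Submodule.quotientRel_def _).1 h) ((Submodule.quotientRel_def _).1 h')))⟩
  letI : Min I.Quot := ⟨fun x y => Quotient.liftOn₂' x y (fun a b => I.proj (a ⊓ b))
    (fun _ _ _ _ h h' => mk_eq_mk.2 (I.inf_sub_inf_mem
      ((Submodule.quotientRel_def _).1 h) ((Submodule.quotientRel_def _).1 h')))⟩
  Lattice.mk'
    (by
      intro x y
      obtain ⟨a, rfl⟩ := I.mk_surjective x
      obtain ⟨b, rfl⟩ := I.mk_surjective y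
      exact congrArg I.proj (sup_comm a b))
    (by
      intro x y z
      obtain ⟨a, rfl⟩ := I.mk_surjective x
      obtain ⟨b, rfl⟩ := I.mk_surjective y
      obtain ⟨c, rfl⟩ := I.mk_surjective z
      exact congrArg I.proj (sup_assoc a b c))
    (by
      intro x y
      obtain ⟨a, rfl⟩ := I.mk_surjective x
      obtain ⟨b, rfl⟩ := I.mk_surjective y
      exact congrArg I.proj (inf_comm a b))
    (by
      intro x y z
      obtain ⟨a, rfl⟩ := I.mk_surjective x
      obtain ⟨b, rfl⟩ := I.mk_surjective y
      obtain ⟨c, rfl⟩ := I.mk_surjective z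
      exact congrArg I.proj (inf_assoc a b c))
    (by
      intro x y
      obtain ⟨a, rfl⟩ := I.mk_surjective x
      obtain ⟨b, rfl⟩ := I.mk_surjective y
      exact congrArg I.proj (sup_inf_self (a := a) (b := b)))
    (by
      intro x y
      obtain ⟨a, rfl⟩ := I.mk_surjective x
      obtain ⟨b, rfl⟩ := I.mk_surjective y
      exact congrArg I.proj (inf_sup_self (a := a) (b := b)))

theorem mk_sup (I : LIdeal A) (a b : A) : I.proj (a ⊔ b) = I.proj a ⊔ I.proj b := rfl

theorem mk_inf (I : LIdeal A) (a b : A) : I.proj (a ⊓ b) = I.proj a ⊓ I.proj b := rfl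

theorem mk_mono (I : LIdeal A) {a b : A} (h : a ≤ b) : I.proj a ≤ I.proj b := by
  rw [← sup_eq_right, ← mk_sup, sup_eq_right.2 h]

theorem mk_le_mk {I : LIdeal A} {a b : A} : I.proj a ≤ I.proj b ↔ (a - b) ⊔ 0 ∈ I := by
  rw [← sup_eq_right, ← mk_sup, mk_eq_mk, sup_sub, sub_self]

theorem exists_nonneg_rep {I : LIdeal A} {x : I.Quot} (hx : 0 ≤ x) : ∃ a : A, 0 ≤ a ∧ I.proj a = x := by
  obtain ⟨a, rfl⟩ := I.mk_surjective x
  refine ⟨a ⊔ 0, le_sup_right, ?_⟩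
  rw [mk_sup, map_zero]; exact sup_eq_left.2 hx

instance (I : LIdeal A) : IsLAlgebra I.Quot where
  add_le_add_right' x y h z := by
    obtain ⟨a, rfl⟩ := I.mk_surjective x
    obtain ⟨b, rfl⟩ := I.mk_surjective y
    obtain ⟨c, rfl⟩ := I.mk_surjective z
    rw [← map_add, ← map_add]
    rw [mk_le_mk] at h ⊢
    rwa [add_sub_add_right_eq_sub]
  mul_nonneg' x y hx hy := by
    obtain ⟨a, ha, rfl⟩ := exists_nonneg_rep hx
    obtain ⟨b, hb, rfl⟩ := exists_nonneg_rep hy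
    have := I.mk_mono (mul_nonneg_of ha hb)
    rwa [map_zero, map_mul] at this
  smul_nonneg' r x hr hx := by
    obtain ⟨a, ha, rfl⟩ := exists_nonneg_rep hx
    have := I.mk_mono (smul_nonneg hr ha)
    rwa [map_zero, mk_smul] at this

/-- An `ℓ`-ideal `I` is archimedean if `A / I` is archimedean. -/
def IsArch (I : LIdeal A) : Prop := IsArchimedean I.Quot

theorem isArch_iff {I : LIdeal A} :
    I.IsArch ↔ ∀ a b : A, (∀ n : ℕ, (n • a - b) ⊔ 0 ∈ I) → a ⊔ 0 ∈ I := by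
  have key : ∀ (a b : A) (n : ℕ), n • I.proj a ≤ I.proj b ↔ (n • a - b) ⊔ 0 ∈ I := by
    intro a b n
    rw [← map_nsmul, mk_le_mk]
  have key0 : ∀ a : A, I.proj a ≤ 0 ↔ a ⊔ 0 ∈ I := by
    intro a
    rw [← map_zero I.proj, mk_le_mk, sub_zero]
  constructor
  · intro h a b hab
    exact (key0 a).1 (h _ _ fun n => (key a b n).2 (hab n))
  · intro h x y hxy
    obtain ⟨a, rfl⟩ := I.mk_surjective x
    obtain ⟨b, rfl⟩ := I.mk_surjective y
    exact (key0 a).2 (h a b fun n => (key a b n).1 (hxy n))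

/-- The archimedean `ℓ`-ideal generated by `S`: the least archimedean `ℓ`-ideal containing `S`. -/
def archGen (S : Set A) : LIdeal A := genWith IsArch S

theorem subset_archGen (S : Set A) : S ⊆ archGen S := fun _ ha _ _ hS => hS ha

theorem archGen_subset {S : Set A} {I : LIdeal A} (hI : I.IsArch) (h : S ⊆ I) {a : A}
    (ha : a ∈ archGen S) : a ∈ I := ha I hI h

theorem archGen_isArch (S : Set A) : (archGen S).IsArch :=
  isArch_iff.2 fun a b h I hI hS => isArch_iff.1 hI a b fun n => h n I hI hS

end Quotient

section QuotientBal

variable {A : Type*} [CommRing A] [Lattice A] [Algebra ℝ A] [IsBal A]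

instance (S : Set A) : IsBal (archGen S).Quot where
  bounded x := by
    obtain ⟨a, rfl⟩ := (archGen S).mk_surjective x
    obtain ⟨n, hn⟩ := IsBal.bounded a
    refine ⟨n, ?_⟩
    have := (archGen S).mk_mono hn
    rwa [map_nsmul, map_one] at this
  archimedean := archGen_isArch S

/-- The quotient map as a morphism of `ℓ`-algebras. -/
def mkHom (I : LIdeal A) : BalHom A I.Quot where
  toAlgHom := Ideal.Quotient.mkₐ ℝ I.ideal
  map_sup' _ _ := rfl
  map_inf' _ _ := rfl

theorem mkHom_apply (I : LIdeal A) (a : A) : I.mkHom a = I.proj a := rfl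

variable {B : Type*} [CommRing B] [Lattice B] [Algebra ℝ B] [IsBal B]

/-- The kernel of a morphism. -/
def ker (f : BalHom A B) : LIdeal A where
  ideal := RingHom.ker f.toAlgHom
  solid a b hab hb := by
    have h1 : f b = 0 := hb
    have h2 := f.map_mono hab
    rw [f.map_abs', f.map_abs', h1, abs_zero] at h2
    have h3 : f a = 0 := by
      refine le_antisymm ((le_abs_self _).trans h2) ?_
      have := (neg_le_abs (f a)).trans h2
      simpa using this
    exact h3

theorem mem_ker {f : BalHom A B} {a : A} : a ∈ ker f ↔ f a = 0 := Iff.rfl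

theorem ker_isArch (f : BalHom A B) : (ker f).IsArch := by
  rw [isArch_iff]
  intro a b h
  have hb : ∀ n : ℕ, n • f a ≤ f b := by
    intro n
    have := mem_ker.1 (h n)
    rw [map_sup, map_sub, map_nsmul, map_zero] at this
    exact sub_nonpos.1 (sup_eq_right.1 this)
  rw [mem_ker, map_sup, map_zero]
  exact sup_eq_right.2 (IsBal.archimedean _ _ hb)

/-- A morphism that vanishes on `S` factors through the quotient by `archGen S`. -/
def quotLift (S : Set A) (f : BalHom A B) (hf : ∀ a ∈ S, f a = 0) :
    BalHom (archGen S).Quot B where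
  toAlgHom := Ideal.Quotient.liftₐ (archGen S).ideal f.toAlgHom
    fun _ ha => mem_ker.1 (archGen_subset (ker_isArch f) hf ha)
  map_sup' x y := by
    obtain ⟨a, rfl⟩ := (archGen S).mk_surjective x
    obtain ⟨b, rfl⟩ := (archGen S).mk_surjective y
    exact f.map_sup' a b
  map_inf' x y := by
    obtain ⟨a, rfl⟩ := (archGen S).mk_surjective x
    obtain ⟨b, rfl⟩ := (archGen S).mk_surjective y
    exact f.map_inf' a b

theorem quotLift_mk (S : Set A) (f : BalHom A B) (hf : ∀ a ∈ S, f a = 0) (a : A) :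
    quotLift S f hf ((archGen S).proj a) = f a := rfl

end QuotientBal

end LIdeal

/-! ### Free bounded archimedean `ℓ`-algebras over weighted sets -/

section Free

variable {X : Type u}

/-- The real-valued functions on `X` dominated by the weight `w`. -/
def WeightBox (w : X → ℝ≥0) : Type u := {p : X → ℝ // ∀ x, |p x| ≤ w x}

/-- The smallest set of functions on `WeightBox w` that contains the coordinate functions and the
constants and is closed under sums, products, joins and meets. -/
inductive FreeMem (w : X → ℝ≥0) : (WeightBox w → ℝ) → Prop
  | coord (x : X) : FreeMem w (fun p => p.1 x)
  | const (r : ℝ) : FreeMem w (fun _ => r)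
  | add {f g : WeightBox w → ℝ} : FreeMem w f → FreeMem w g → FreeMem w (f + g)
  | mul {f g : WeightBox w → ℝ} : FreeMem w f → FreeMem w g → FreeMem w (f * g)
  | sup {f g : WeightBox w → ℝ} : FreeMem w f → FreeMem w g → FreeMem w (f ⊔ g)
  | inf {f g : WeightBox w → ℝ} : FreeMem w f → FreeMem w g → FreeMem w (f ⊓ g)

def freeSubalgebra (w : X → ℝ≥0) : Subalgebra ℝ (WeightBox w → ℝ) where
  carrier := {f | FreeMem w f}
  mul_mem' := .mul
  add_mem' := .add
  algebraMap_mem' r := .const r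

/-- The free bounded archimedean `ℓ`-algebra over the weighted set `(X, w)`, realized as the
`ℓ`-algebra of functions on `WeightBox w` generated by the coordinate functions. Its universal
property is `FreeBal.lift_of` together with `FreeBal.hom_ext`. -/
def FreeBal (w : X → ℝ≥0) : Type u := {f : WeightBox w → ℝ // FreeMem w f}

namespace FreeBal

variable (w : X → ℝ≥0)

instance : CommRing (FreeBal w) := inferInstanceAs (CommRing (freeSubalgebra w))

instance : Algebra ℝ (FreeBal w) := inferInstanceAs (Algebra ℝ (freeSubalgebra w))

instance : Lattice (FreeBal w) := Subtype.lattice (fun _ _ => .sup) (fun _ _ => .inf)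

variable {w}

theorem le_def {f g : FreeBal w} : f ≤ g ↔ ∀ p, f.1 p ≤ g.1 p := Iff.rfl
theorem add_val (f g : FreeBal w) (p : WeightBox w) : (f + g).1 p = f.1 p + g.1 p := rfl
theorem mul_val (f g : FreeBal w) (p : WeightBox w) : (f * g).1 p = f.1 p * g.1 p := rfl
theorem smul_val (r : ℝ) (f : FreeBal w) (p : WeightBox w) : (r • f).1 p = r * f.1 p := rfl
theorem sup_val (f g : FreeBal w) (p : WeightBox w) : (f ⊔ g).1 p = f.1 p ⊔ g.1 p := rfl
theorem inf_val (f g : FreeBal w) (p : WeightBox w) : (f ⊓ g).1 p = f.1 p ⊓ g.1 p := rfl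
theorem zero_val (p : WeightBox w) : (0 : FreeBal w).1 p = 0 := rfl
theorem one_val (p : WeightBox w) : (1 : FreeBal w).1 p = 1 := rfl

theorem nsmul_val (n : ℕ) (f : FreeBal w) (p : WeightBox w) : (n • f).1 p = n * f.1 p := by
  rw [← Nat.cast_smul_eq_nsmul ℝ, smul_val]

theorem FreeMem_bounded {f : WeightBox w → ℝ} (hf : FreeMem w f) : ∃ r : ℝ, ∀ p, |f p| ≤ r := by
  induction hf with
  | coord x => exact ⟨w x, fun p => p.2 x⟩
  | const r => exact ⟨|r|, fun _ => le_rfl⟩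
  | add _ _ hf hg =>
    obtain ⟨r, hr⟩ := hf
    obtain ⟨s, hs⟩ := hg
    exact ⟨r + s, fun p => (abs_add_le _ _).trans (add_le_add (hr p) (hs p))⟩
  | mul _ _ hf hg =>
    obtain ⟨r, hr⟩ := hf
    obtain ⟨s, hs⟩ := hg
    refine ⟨r * s, fun p => ?_⟩
    rw [Pi.mul_apply, abs_mul]
    exact mul_le_mul (hr p) (hs p) (abs_nonneg _) ((abs_nonneg _).trans (hr p))
  | sup _ _ hf hg =>
    obtain ⟨r, hr⟩ := hf
    obtain ⟨s, hs⟩ := hg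
    exact ⟨r ⊔ s, fun p => (abs_max_le_max_abs_abs).trans (max_le_max (hr p) (hs p))⟩
  | inf _ _ hf hg =>
    obtain ⟨r, hr⟩ := hf
    obtain ⟨s, hs⟩ := hg
    exact ⟨r ⊔ s, fun p => (abs_min_le_max_abs_abs).trans (max_le_max (hr p) (hs p))⟩

instance : IsBal (FreeBal w) where
  add_le_add_right' _ _ h g p := by
    have := h p
    exact add_le_add_left this (g.1 p)
  mul_nonneg' _ _ hf hg p := mul_nonneg (hf p) (hg p)
  smul_nonneg' _ _ hr hf p := mul_nonneg hr (hf p)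
  bounded f := by
    obtain ⟨r, hr⟩ := FreeMem_bounded f.2
    obtain ⟨n, hn⟩ := exists_nat_ge r
    refine ⟨n, fun p => ?_⟩
    change f.1 p ≤ (n • (1 : FreeBal w)).1 p
    rw [nsmul_val, one_val, mul_one]
    exact (le_abs_self _).trans ((hr p).trans hn)
  archimedean f g h p := by
    change f.1 p ≤ 0
    by_contra hp
    obtain ⟨n, hn⟩ := Archimedean.arch (g.1 p + 1) (not_le.1 hp)
    have h1 : (n • f).1 p ≤ g.1 p := h n p
    rw [nsmul_val] at h1
    rw [nsmul_eq_mul] at hn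
    linarith

/-- The canonical map `X → FreeBal w`. -/
def of (w : X → ℝ≥0) (x : X) : FreeBal w := ⟨fun p => p.1 x, .coord x⟩

theorem balNorm_of_le (x : X) : balNorm (of w x) ≤ w x := by
  rcases subsingleton_or_nontrivial (FreeBal w) with h | h
  · simp [balNorm]
  · refine csInf_le ⟨0, fun r hr => nonneg_of_abs_le (a := of w x) hr⟩ ?_
    refine abs_le'.2 ⟨le_def.2 fun p => ?_, le_def.2 fun p => ?_⟩
    · change p.1 x ≤ (w x : ℝ) * 1
      rw [mul_one]; exact (le_abs_self _).trans (p.2 x)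
    · change -(p.1 x) ≤ (w x : ℝ) * 1
      rw [mul_one]; exact (neg_le_abs _).trans (p.2 x)

variable {B : Type v} [CommRing B] [Lattice B] [Algebra ℝ B] [IsBal B]

/-- The point of `WeightBox w` given by a weighted map `g : X → B` and a maximal `ℓ`-ideal. -/
noncomputable def point (g : X → B) (hg : ∀ x, balNorm (g x) ≤ w x) (M : YosidaSpace B) :
    WeightBox w :=
  ⟨fun x => M.value (g x), fun x => (M.abs_value_le (g x)).trans (hg x)⟩

theorem exists_lift (g : X → B) (hg : ∀ x, balNorm (g x) ≤ w x) {f : WeightBox w → ℝ}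
    (hf : FreeMem w f) : ∃ b : B, ∀ M, M.value b = f (point g hg M) := by
  induction hf with
  | coord x => exact ⟨g x, fun _ => rfl⟩
  | const r => exact ⟨r • (1 : B), fun M => M.value_smul_one r⟩
  | add _ _ hf hg =>
    obtain ⟨a, ha⟩ := hf
    obtain ⟨b, hb⟩ := hg
    exact ⟨a + b, fun M => by rw [M.value_add, ha, hb]; rfl⟩
  | mul _ _ hf hg =>
    obtain ⟨a, ha⟩ := hf
    obtain ⟨b, hb⟩ := hg
    exact ⟨a * b, fun M => by rw [M.value_mul, ha, hb]; rfl⟩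
  | sup _ _ hf hg =>
    obtain ⟨a, ha⟩ := hf
    obtain ⟨b, hb⟩ := hg
    exact ⟨a ⊔ b, fun M => by rw [M.value_sup, ha, hb]; rfl⟩
  | inf _ _ hf hg =>
    obtain ⟨a, ha⟩ := hf
    obtain ⟨b, hb⟩ := hg
    exact ⟨a ⊓ b, fun M => by rw [M.value_inf, ha, hb]; rfl⟩

noncomputable def liftFun (g : X → B) (hg : ∀ x, balNorm (g x) ≤ w x) (f : FreeBal w) : B :=
  (exists_lift g hg f.2).choose

theorem value_liftFun (g : X → B) (hg : ∀ x, balNorm (g x) ≤ w x) (f : FreeBal w)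
    (M : YosidaSpace B) : M.value (liftFun g hg f) = f.1 (point g hg M) :=
  (exists_lift g hg f.2).choose_spec M

/-- A weighted set morphism `g : (X, w) → (B, ‖·‖)` extends to a morphism `FreeBal w → B`. -/
noncomputable def lift (g : X → B) (hg : ∀ x, balNorm (g x) ≤ w x) : BalHom (FreeBal w) B where
  toAlgHom := AlgHom.ofLinearMap
    { toFun := liftFun g hg
      map_add' := fun f h => YosidaSpace.ext_of_value fun M => by
        rw [M.value_add, value_liftFun, value_liftFun, value_liftFun, add_val]
      map_smul' := fun r f => YosidaSpace.ext_of_value fun M => by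
        have e : r • liftFun g hg f = (r • (1 : B)) * liftFun g hg f := by
          rw [smul_mul_assoc, one_mul]
        rw [RingHom.id_apply, e, M.value_mul, M.value_smul_one, value_liftFun, value_liftFun,
          smul_val] }
    (YosidaSpace.ext_of_value fun M => by
      have : M.value (1 : B) = 1 := by simpa using M.value_smul_one 1
      rw [this]; exact (value_liftFun g hg 1 M).trans rfl)
    (fun f h => YosidaSpace.ext_of_value fun M => by
      change M.value (liftFun g hg (f * h)) = M.value (liftFun g hg f * liftFun g hg h)
      rw [M.value_mul, value_liftFun, value_liftFun, value_liftFun, mul_val])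
  map_sup' f h := YosidaSpace.ext_of_value fun M => by
    change M.value (liftFun g hg (f ⊔ h)) = M.value (liftFun g hg f ⊔ liftFun g hg h)
    rw [M.value_sup, value_liftFun, value_liftFun, value_liftFun, sup_val]
  map_inf' f h := YosidaSpace.ext_of_value fun M => by
    change M.value (liftFun g hg (f ⊓ h)) = M.value (liftFun g hg f ⊓ liftFun g hg h)
    rw [M.value_inf, value_liftFun, value_liftFun, value_liftFun, inf_val]

theorem lift_of (g : X → B) (hg : ∀ x, balNorm (g x) ≤ w x) (x : X) :
    lift g hg (of w x) = g x :=
  YosidaSpace.ext_of_value fun M => value_liftFun g hg (of w x) M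

/-- The element of `FreeBal w` with a given underlying function. -/
def elt {f : WeightBox w → ℝ} (hf : FreeMem w f) : FreeBal w := ⟨f, hf⟩

theorem hom_ext {φ ψ : BalHom (FreeBal w) B} (h : ∀ x, φ (of w x) = ψ (of w x)) : φ = ψ := by
  refine BalHom.hom_ext fun F => ?_
  suffices H : ∀ (f : WeightBox w → ℝ) (hf : FreeMem w f),
      φ (elt hf) = ψ (elt hf) from H F.1 F.2
  intro f hf
  induction hf with
  | coord x => exact h x
  | const r => exact (φ.toAlgHom.commutes r).trans (ψ.toAlgHom.commutes r).symm
  | @add f g hf hg ihf ihg =>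
    have e : elt (.add hf hg) = elt hf + elt hg := rfl
    rw [e, map_add, map_add, ihf, ihg]
  | @mul f g hf hg ihf ihg =>
    have e : elt (.mul hf hg) = elt hf * elt hg := rfl
    rw [e, map_mul, map_mul, ihf, ihg]
  | @sup f g hf hg ihf ihg =>
    have e : elt (.sup hf hg) = elt hf ⊔ elt hg := rfl
    rw [e, map_sup, map_sup, ihf, ihg]
  | @inf f g hf hg ihf ihg =>
    have e : elt (.inf hf hg) = elt hf ⊓ elt hg := rfl
    rw [e, map_inf, map_inf, ihf, ihg]

end FreeBal

end Free


/-! ### The categories and functors -/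

/-- The category of bounded archimedean `ℓ`-algebras and unital `ℓ`-algebra morphisms. -/
structure Bal : Type (u + 1) where
  carrier : Type u
  [commRing : CommRing carrier]
  [lattice : Lattice carrier]
  [algebra : Algebra ℝ carrier]
  [isBal : IsBal carrier]

namespace Bal

instance : CoeSort Bal.{u} (Type u) := ⟨Bal.carrier⟩

attribute [instance] Bal.commRing Bal.lattice Bal.algebra Bal.isBal

instance : Category Bal.{u} where
  Hom A B := BalHom A B
  id A := BalHom.id A
  comp f g := g.comp f

end Bal

/-- The weight `w_A(a) = max {‖a‖, 1}`. -/
noncomputable def boxWeight (A : Bal.{u}) (a : A) : ℝ≥0 := (max (balNorm a) 1).toNNReal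

theorem coe_boxWeight (A : Bal.{u}) (a : A) : (boxWeight A a : ℝ) = max (balNorm a) 1 :=
  Real.coe_toNNReal _ (zero_le_one.trans (le_max_right _ _))

/-- The free object `F(A)` over the weighted set `(A, w_A)`. -/
abbrev FreeOn (A : Bal.{u}) : Type u := FreeBal (boxWeight A)

/-- The canonical map `f_A : A → F(A)`. -/
noncomputable def freeOf (A : Bal.{u}) (a : A) : FreeOn A := FreeBal.of (boxWeight A) a

/-- The generators of the archimedean `ℓ`-ideal `I*_A` of `F(A)`. -/
inductive StarRel (A : Bal.{u}) : FreeOn A → Prop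
  | inf (a b : A) : StarRel A (freeOf A (a ⊓ b) - (freeOf A a ⊓ freeOf A b))
  | pos (a : A) : StarRel A (freeOf A (a ⊔ 0) - (freeOf A a ⊔ 0))
  | add (a : A) (r : ℝ) : StarRel A (freeOf A (a + r • 1) - freeOf A a - r • 1)
  | smul (a : A) (r : ℝ) : 0 ≤ r → StarRel A (freeOf A (r • a) - r • freeOf A a)

/-- The archimedean `ℓ`-ideal `I*_A`. -/
noncomputable abbrev starIdeal (A : Bal.{u}) : LIdeal (FreeOn A) := LIdeal.archGen {x | StarRel A x}

/-- `H*(A) = F(A) / I*_A`. -/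
noncomputable def hStarObj (A : Bal.{u}) : Bal.{u} where
  carrier := (starIdeal A).Quot

/-- The element `□*_a` of `H*(A)`. -/
noncomputable def boxStar (A : Bal.{u}) (a : A) : hStarObj A := (starIdeal A).proj (freeOf A a)

theorem balNorm_freeOf_map_le {A B : Bal.{u}} (f : BalHom A B) (a : A) :
    balNorm (freeOf B (f a)) ≤ boxWeight A a := by
  refine (FreeBal.balNorm_of_le (w := boxWeight B) (f a)).trans ?_
  rw [coe_boxWeight, coe_boxWeight]
  exact max_le_max_right 1 (f.balNorm_map_le a)

/-- The morphism `F(A) → F(B)` induced by a morphism `A → B`. -/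
noncomputable def freeMap {A B : Bal.{u}} (f : BalHom A B) : BalHom (FreeOn A) (FreeOn B) :=
  FreeBal.lift (fun a => freeOf B (f a)) (balNorm_freeOf_map_le f)

theorem freeMap_freeOf {A B : Bal.{u}} (f : BalHom A B) (a : A) :
    freeMap f (freeOf A a) = freeOf B (f a) := FreeBal.lift_of _ _ a

theorem freeMap_starRel {A B : Bal.{u}} (f : BalHom A B) {x : FreeOn A} (hx : StarRel A x) :
    StarRel B (freeMap f x) := by
  cases hx with
  | inf a b =>
    rw [map_sub, map_inf, freeMap_freeOf, freeMap_freeOf, freeMap_freeOf, map_inf]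
    exact .inf _ _
  | pos a =>
    rw [map_sub, map_sup, freeMap_freeOf, freeMap_freeOf, map_sup, map_zero, map_zero]
    exact .pos _
  | add a r =>
    rw [map_sub, map_sub, freeMap_freeOf, freeMap_freeOf, map_add, BalHom.map_smul_one,
      BalHom.map_smul_one]
    exact .add _ _
  | smul a r hr =>
    rw [map_sub, map_smul, freeMap_freeOf, freeMap_freeOf, map_smul]
    exact .smul _ _ hr

/-- The morphism `H*(f) : H*(A) → H*(B)`, determined by `□*_a ↦ □*_{f(a)}`. -/
noncomputable def hStarMap {A B : Bal.{u}} (f : BalHom A B) :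
    BalHom (hStarObj A) (hStarObj B) :=
  LIdeal.quotLift {x | StarRel A x} ((starIdeal B).mkHom.comp (freeMap f))
    (fun _ hx => LIdeal.mk_eq_zero.2 (LIdeal.subset_archGen _ (freeMap_starRel f hx)))

theorem hStarMap_boxStar {A B : Bal.{u}} (f : BalHom A B) (a : A) :
    hStarMap f (boxStar A a) = boxStar B (f a) :=
  congrArg (starIdeal B).proj (freeMap_freeOf f a)

theorem hStar_hom_ext {A B : Bal.{u}} {φ ψ : BalHom (hStarObj A) B}
    (h : ∀ a, φ (boxStar A a) = ψ (boxStar A a)) : φ = ψ := by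
  have key : φ.comp (starIdeal A).mkHom = ψ.comp (starIdeal A).mkHom := FreeBal.hom_ext h
  refine BalHom.hom_ext fun x => ?_
  obtain ⟨y, rfl⟩ := (starIdeal A).mk_surjective x
  exact DFunLike.congr_fun key y

/-- The endofunctor `H*` of the category of bounded archimedean `ℓ`-algebras. -/
noncomputable def HStar : Bal.{u} ⥤ Bal.{u} where
  obj := hStarObj
  map f := hStarMap f
  map_id A := hStar_hom_ext fun a => hStarMap_boxStar (BalHom.id A) a
  map_comp f g := hStar_hom_ext fun a =>
    (hStarMap_boxStar (BalHom.comp g f) a).trans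
      ((congrArg (hStarMap g) (hStarMap_boxStar f a)).trans (hStarMap_boxStar g _)).symm

/-- The endofunctor `V*` of compact Hausdorff spaces: `V*(X)` is the set of nonempty closed
(equivalently, nonempty compact) subsets of `X` with the Vietoris topology, and `V*(φ)` sends
a set to its image under `φ`. -/
noncomputable def VStar : CompHaus.{u} ⥤ CompHaus.{u} where
  obj X := CompHaus.of (TopologicalSpace.NonemptyCompacts X)
  map f := CompHausLike.ofHom _
    { toFun := fun K => K.map f f.hom.hom.continuous
      continuous_toFun := f.hom.hom.continuous.nonemptyCompacts_map }
  map_id X := ConcreteCategory.hom_ext _ _ fun K => TopologicalSpace.NonemptyCompacts.map_id K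
  map_comp f g := ConcreteCategory.hom_ext _ _ fun K =>
    TopologicalSpace.NonemptyCompacts.map_comp _ _ g.hom.hom.continuous f.hom.hom.continuous K

instance (X : Type u) [TopologicalSpace X] [CompactSpace X] : IsBal C(X, ℝ) where
  add_le_add_right' _ _ h g x := add_le_add_left (h x) (g x)
  mul_nonneg' _ _ hf hg x := mul_nonneg (hf x) (hg x)
  smul_nonneg' _ _ hr hf x := mul_nonneg hr (hf x)
  bounded f := by
    obtain ⟨n, hn⟩ := exists_nat_ge ‖f‖
    refine ⟨n, fun x => ?_⟩
    have h1 : f x ≤ ‖f‖ := (le_abs_self _).trans (f.norm_coe_le_norm x)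
    simpa using h1.trans hn
  archimedean f g h x := by
    change f x ≤ 0
    by_contra hx
    obtain ⟨n, hn⟩ := Archimedean.arch (g x + 1) (not_le.1 hx)
    have h1 : n • f x ≤ g x := h n x
    linarith

/-- The contravariant functor `C` sending `X` to the algebra `C(X)` of continuous real-valued
functions and `φ` to `f ↦ f ∘ φ`. -/
def contFunctor : CompHaus.{u}ᵒᵖ ⥤ Bal.{u} where
  obj X := { carrier := C(X.unop, ℝ) }
  map φ :=
    { toAlgHom := ContinuousMap.compRightAlgHom ℝ ℝ φ.unop.hom.hom
      map_sup' := fun _ _ => rfl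
      map_inf' := fun _ _ => rfl }
  map_id _ := rfl
  map_comp _ _ := rfl

/-- The contravariant functor `Y` sending `A` to its Yosida space and `f` to `M ↦ f⁻¹(M)`. -/
def yosidaFunctor : Bal.{u} ⥤ CompHaus.{u}ᵒᵖ where
  obj A := Opposite.op (CompHaus.of (YosidaSpace A))
  map f := (CompHausLike.ofHom _ (YosidaSpace.map f)).op
  map_id _ := rfl
  map_comp _ _ := rfl

/-- `Alg(H*)`. -/
abbrev AlgHStar : Type (u + 1) := Endofunctor.Algebra HStar.{u}

/-- `Coalg(V*)`. -/
abbrev CoalgVStar : Type (u + 1) := Endofunctor.Coalgebra VStar.{u}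

/-- The property of objects `(A, α)` of `Alg(H*)` that `A` is uniformly complete; its full
subcategory is `Alg^u(H*)`. -/
def AlgUHStar : ObjectProperty AlgHStar.{u} := fun X => UniformlyComplete X.a

end BalDuality

/-! The base is Yosida duality. A bounded archimedean `ℓ`-algebra `A` embeds isometrically in
`C(Y(A))`, with dense image by Stone–Weierstrass, so the embedding is an isomorphism when `A` is
uniformly complete; and a compact Hausdorff space `X` is homeomorphic to `Y(C(X))` through its point
evaluations.

What is specific to `H*` is a homeomorphism between `V*(Y(A))` and `Y(H*(A))` (`vietorisHomeo`). A
point of `Y(H*(A))` is a morphism `H*(A) → ℝ`, that is, a function `g : A → ℝ` bounded by the weight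
that preserves binary meets, positive parts, translations by constants and nonnegative multiples.
For a nonempty closed `K ⊆ Y(A)`, the function `a ↦ min_K a` has these properties. Conversely, such
a `g` is the minimum over `K = {M | g b ≤ b(M) for all b}`; the point is that every value `g a` is
attained on `K`, and this is a compactness argument (`exists_minVal_eq`). The set `K` is recovered
from its minima because closed sets of `Y(A)` are zero sets of `ℓ`-ideals (`ext_minVal`). The
resulting bijection is continuous because minima depend continuously on `K` in the Vietoris topology
(`continuous_minOn`), and a continuous bijection from a compact space to a Hausdorff space is a
homeomorphism.

An algebra structure `α` on `A` thus gives a coalgebra structure `σ` on `Y(A)`, and a coalgebra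
structure on `X` gives an algebra structure on `C(X)`. Both passages obey one formula: the value of
`α(□a)` at `x` is the minimum of `a` over `σ(x)` (`minVal_coalgStr`, `algStr_boxStar`). Morphisms
out of `H*(A)` are determined on the elements `□a`, and closed sets by their minima, so this formula
yields all the commuting squares. Hence the Yosida unit and counit lift to algebras and coalgebras,
and the triangle identities and invertibility are inherited from Yosida duality. -/

namespace BalDuality

open TopologicalSpace

/-! ### Minima of continuous functions over nonempty compact sets -/

section MinOn

variable {X Y : Type*} [TopologicalSpace X] [TopologicalSpace Y]

/-- The infimum of a real-valued function over a nonempty compact set. -/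
noncomputable def minOn (K : NonemptyCompacts X) (h : X → ℝ) : ℝ := sInf (h '' K)

theorem minOn_eq {K : NonemptyCompacts X} {h : X → ℝ} {x : X} (hx : x ∈ K)
    (hmin : ∀ y ∈ K, h x ≤ h y) : minOn K h = h x :=
  IsLeast.csInf_eq ⟨⟨x, hx, rfl⟩, by rintro _ ⟨y, hy, rfl⟩; exact hmin y hy⟩

theorem exists_eq_minOn (K : NonemptyCompacts X) {h : X → ℝ} (hh : Continuous h) :
    ∃ x ∈ K, minOn K h = h x := by
  obtain ⟨x, hx, hmin⟩ := K.isCompact.exists_isMinOn K.nonempty hh.continuousOn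
  exact ⟨x, hx, minOn_eq hx fun y hy => hmin hy⟩

theorem minOn_le {K : NonemptyCompacts X} {h : X → ℝ} (hh : Continuous h) {x : X} (hx : x ∈ K) :
    minOn K h ≤ h x := by
  obtain ⟨y, hy, hmin⟩ := K.isCompact.exists_isMinOn K.nonempty hh.continuousOn
  rw [minOn_eq hy fun y hy => hmin hy]
  exact hmin hx

theorem le_minOn {K : NonemptyCompacts X} {h : X → ℝ} (hh : Continuous h) {r : ℝ}
    (hr : ∀ x ∈ K, r ≤ h x) : r ≤ minOn K h := by
  obtain ⟨x, hx, e⟩ := exists_eq_minOn K hh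
  exact e ▸ hr x hx

/-- A minimizer of `h` also minimizes `φ ∘ h`. Taking for `φ` truncation at `0`, a translation or a
nonnegative scaling gives three of the four relations of `H*`; `minOn_inf` gives the fourth. -/
theorem minOn_comp_of_monotone {K : NonemptyCompacts X} {h : X → ℝ} (hh : Continuous h)
    {φ : ℝ → ℝ} (hφ : Monotone φ) : minOn K (fun x => φ (h x)) = φ (minOn K h) := by
  obtain ⟨x, hx, e⟩ := exists_eq_minOn K hh
  rw [e]
  exact minOn_eq (h := fun x => φ (h x)) hx fun y hy => hφ (e ▸ minOn_le hh hy)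

theorem minOn_inf {K : NonemptyCompacts X} {g h : X → ℝ} (hg : Continuous g) (hh : Continuous h) :
    minOn K (fun x => g x ⊓ h x) = minOn K g ⊓ minOn K h := by
  refine le_antisymm (le_inf (le_minOn hg fun x hx => ?_) (le_minOn hh fun x hx => ?_))
    (le_minOn (hg.inf hh) fun x hx => inf_le_inf (minOn_le hg hx) (minOn_le hh hx))
  · exact (minOn_le (hg.inf hh) hx).trans inf_le_left
  · exact (minOn_le (hg.inf hh) hx).trans inf_le_right

theorem minOn_map (K : NonemptyCompacts X) {f : X → Y} (hf : Continuous f) (h : Y → ℝ) :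
    minOn (K.map f hf) h = minOn K (fun x => h (f x)) := by
  unfold minOn
  rw [NonemptyCompacts.coe_map, Set.image_image]

/-- Since the minimum is attained, it exceeds `r` exactly when `K` lies inside the open set `{h >
r}`, and it is below `r` exactly when `K` meets the open set `{h < r}`. These are the two kinds of
subbasic open sets of the Vietoris topology. -/
theorem continuous_minOn {h : X → ℝ} (hh : Continuous h) :
    Continuous fun K : NonemptyCompacts X => minOn K h := by
  rw [OrderTopology.continuous_iff]
  intro r
  constructor
  · have e : (fun K : NonemptyCompacts X => minOn K h) ⁻¹' Set.Ioi r =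
        {K : NonemptyCompacts X | (K : Set X) ⊆ h ⁻¹' Set.Ioi r} := by
      ext K
      constructor
      · intro hK x hx
        exact lt_of_lt_of_le hK (minOn_le hh hx)
      · intro hK
        obtain ⟨x, hx, e⟩ := exists_eq_minOn K hh
        change r < minOn K h
        rw [e]; exact hK hx
    rw [e]
    exact NonemptyCompacts.isOpen_subsets_of_isOpen (isOpen_Ioi.preimage hh)
  · have e : (fun K : NonemptyCompacts X => minOn K h) ⁻¹' Set.Iio r =
        {K : NonemptyCompacts X | ((K : Set X) ∩ h ⁻¹' Set.Iio r).Nonempty} := by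
      ext K
      constructor
      · intro hK
        obtain ⟨x, hx, e⟩ := exists_eq_minOn K hh
        exact ⟨x, hx, show h x < r from e ▸ hK⟩
      · rintro ⟨x, hx, hxr⟩
        exact lt_of_le_of_lt (minOn_le hh hx) hxr
    rw [e]
    exact NonemptyCompacts.isOpen_inter_nonempty_of_isOpen (isOpen_Iio.preimage hh)

end MinOn

/-! ### Points of the Yosida space as real-valued morphisms -/

/-- With `ℝ` as a target, a maximal `ℓ`-ideal can be exchanged for the real-valued morphism of which
it is the kernel. -/
instance : IsBal ℝ where
  add_le_add_right' _ _ h c := add_le_add_left h c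
  mul_nonneg' _ _ := mul_nonneg
  smul_nonneg' _ _ hr ha := mul_nonneg hr ha
  bounded a := by
    obtain ⟨n, hn⟩ := exists_nat_ge a
    exact ⟨n, by simpa using hn⟩
  archimedean a b h := by
    by_contra ha
    obtain ⟨n, hn⟩ := Archimedean.arch (b + 1) (not_le.1 ha)
    have := h n
    linarith

namespace YosidaSpace

section

variable {A : Type*} [CommRing A] [Lattice A] [Algebra ℝ A] [IsBal A]

theorem value_smul (M : YosidaSpace A) (r : ℝ) (a : A) : M.value (r • a) = r * M.value a := by
  have e : r • a = (r • (1 : A)) * a := by rw [smul_mul_assoc, one_mul]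
  rw [e, value_mul, value_smul_one]

theorem value_zero (M : YosidaSpace A) : M.value 0 = 0 := value_eq_zero.2 M.1.zero_mem

theorem value_sub (M : YosidaSpace A) (a b : A) : M.value (a - b) = M.value a - M.value b := by
  rw [sub_eq_add_neg, value_add, value_neg, sub_eq_add_neg]

theorem value_abs (M : YosidaSpace A) (a : A) : M.value |a| = |M.value a| := by
  simp only [abs, value_sup, value_neg]

/-- The inequality is the equation `a ⊔ b = b`, so it can be tested at points by `ext_of_value`,
where the archimedean property enters. -/
theorem le_of_value {a b : A} (h : ∀ M : YosidaSpace A, M.value a ≤ M.value b) : a ≤ b := by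
  rw [← sup_eq_right]
  exact ext_of_value fun M => by rw [value_sup, sup_eq_right.2 (h M)]

/-- Evaluation at a point of the Yosida space. -/
noncomputable def evalHom (M : YosidaSpace A) : BalHom A ℝ where
  toAlgHom := AlgHom.ofLinearMap
    { toFun := M.value
      map_add' := M.value_add
      map_smul' := M.value_smul }
    (by simpa using M.value_smul_one 1) M.value_mul
  map_sup' := M.value_sup
  map_inf' := M.value_inf

theorem ext_value {M N : YosidaSpace A} (h : ∀ a, M.value a = N.value a) : M = N :=
  Subtype.ext <| SetLike.ext fun a => by rw [← value_eq_zero, ← value_eq_zero, h]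

/-- Every `a` differs from the scalar `φ a` by an element of the kernel. A larger `ℓ`-ideal
therefore contains a nonzero scalar, hence `1`. -/
theorem ker_isMaximal (φ : BalHom A ℝ) : (LIdeal.ker φ).IsMaximal := by
  refine ⟨⟨1, fun h => one_ne_zero ((map_one φ).symm.trans (LIdeal.mem_ker.1 h))⟩, ?_⟩
  rintro J hJ ⟨x, hx⟩
  refine SetLike.coe_injective (Set.Subset.antisymm (fun a ha => ?_) hJ)
  by_contra h0
  have h1 : a - φ a • (1 : A) ∈ LIdeal.ker φ := by
    rw [LIdeal.mem_ker, map_sub, φ.map_smul_one]; simp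
  have h2 := J.smul_mem (φ a)⁻¹ (J.sub_mem ha (hJ h1))
  rw [sub_sub_cancel, inv_smul_smul₀ (fun h => h0 (LIdeal.mem_ker.2 h))] at h2
  exact hx (LIdeal.eq_univ_of_one_mem h2 x)

/-- The kernel of a real-valued morphism as a point of the Yosida space. -/
def ofHom (φ : BalHom A ℝ) : YosidaSpace A := ⟨LIdeal.ker φ, ker_isMaximal φ⟩

theorem value_ofHom (φ : BalHom A ℝ) (a : A) : (ofHom φ).value a = φ a :=
  value_eq (by
    change a - φ a • (1 : A) ∈ LIdeal.ker φ
    rw [LIdeal.mem_ker, map_sub, φ.map_smul_one]; simp)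

theorem value_map {B : Type*} [CommRing B] [Lattice B] [Algebra ℝ B] [IsBal B] (f : BalHom A B)
    (M : YosidaSpace B) (a : A) : (map f M).value a = M.value (f a) :=
  value_eq (by
    change f (a - M.value (f a) • (1 : A)) ∈ M.1
    rw [map_sub, f.map_smul_one]; exact M.sub_value_mem _)

/-- The set where `b ≤ 0` is the zero set of `b ⊔ 0`, hence closed. The elements `a - r` and `r - a`
then handle both kinds of open rays. -/
theorem continuous_value (a : A) : Continuous fun M : YosidaSpace A => M.value a := by
  have closed_le : ∀ b : A, IsClosed {M : YosidaSpace A | M.value b ≤ 0} := fun b => by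
    convert isClosed_zero (b ⊔ 0) using 1
    ext M
    rw [Set.mem_ofPred_eq, Set.mem_ofPred_eq, ← value_eq_zero, value_sup, value_zero, sup_eq_right]
  rw [OrderTopology.continuous_iff]
  intro r
  constructor
  · have := (closed_le (a - r • 1)).isOpen_compl
    convert this using 1
    ext M
    simp [value_sub, value_smul_one]
  · have := (closed_le (r • 1 - a)).isOpen_compl
    convert this using 1
    ext M
    simp [value_sub, value_smul_one]

/-- Closed sets are intersections of zero sets of elements, so the Yosida topology is the initial
one for the value functions. Continuity of maps into `Y(A)` is always checked this way. -/
theorem continuous_of_value {Z : Type*} [TopologicalSpace Z] {f : Z → YosidaSpace A}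
    (h : ∀ a, Continuous fun z => (f z).value a) : Continuous f := by
  refine continuous_iff_isClosed.2 fun s hs => ?_
  obtain ⟨I, rfl⟩ := isClosed_iff.1 hs
  have e : f ⁻¹' zeroLocus I = ⋂ a ∈ I, {z | (f z).value a = 0} := by
    ext z
    simp only [Set.mem_iInter, Set.mem_ofPred_eq, value_eq_zero]
    rfl
  rw [e]
  exact isClosed_biInter fun a _ => isClosed_eq (h a) continuous_const

/-! ### Closed subsets of the Yosida space and their minimum functionals -/

/-- The minimum of an element over a closed set of the Yosida space. -/
noncomputable def minVal (K : NonemptyCompacts (YosidaSpace A)) (a : A) : ℝ :=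
  minOn K fun M => M.value a

/-- Write `L` as the zero set of `I`. For `a ∈ I` the element `-|a|` vanishes on `L`, so its minimum
over `K` is nonnegative as well, which forces `a` to vanish on `K`. -/
theorem subset_of_minVal_le {K L : NonemptyCompacts (YosidaSpace A)}
    (h : ∀ a, minVal L a ≤ minVal K a) : (K : Set (YosidaSpace A)) ⊆ L := by
  obtain ⟨I, hI⟩ := isClosed_iff.1 L.isCompact.isClosed
  intro M hM
  rw [← hI]
  intro a ha
  have hL : 0 ≤ minVal L (-|a|) := le_minOn (continuous_value _) fun N hN => by
    have : N ∈ zeroLocus I := hI.symm ▸ hN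
    rw [value_neg, value_abs, value_eq_zero.2 (this ha), abs_zero, neg_zero]
  have h1 := (hL.trans (h _)).trans (minOn_le (continuous_value _) hM)
  rw [value_neg, value_abs] at h1
  exact value_eq_zero.1 (abs_eq_zero.1 (le_antisymm (by linarith) (abs_nonneg _)))

theorem ext_minVal {K L : NonemptyCompacts (YosidaSpace A)}
    (h : ∀ a, minVal K a = minVal L a) : K = L :=
  SetLike.coe_injective ((subset_of_minVal_le fun a => (h a).ge).antisymm
    (subset_of_minVal_le fun a => (h a).le))

theorem minVal_inf (K : NonemptyCompacts (YosidaSpace A)) (a b : A) :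
    minVal K (a ⊓ b) = minVal K a ⊓ minVal K b := by
  rw [minVal, funext fun M : YosidaSpace A => M.value_inf a b]
  exact minOn_inf (continuous_value a) (continuous_value b)

theorem minVal_pos (K : NonemptyCompacts (YosidaSpace A)) (a : A) :
    minVal K (a ⊔ 0) = minVal K a ⊔ 0 := by
  rw [minVal, funext fun M : YosidaSpace A => M.value_pos a]
  exact minOn_comp_of_monotone (φ := fun t => t ⊔ 0) (continuous_value a)
    fun s t h => sup_le_sup_right h 0

theorem minVal_add (K : NonemptyCompacts (YosidaSpace A)) (a : A) (r : ℝ) :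
    minVal K (a + r • 1) = minVal K a + r := by
  rw [minVal, funext fun M : YosidaSpace A => (M.value_add a (r • 1)).trans
    (congrArg _ (M.value_smul_one r))]
  exact minOn_comp_of_monotone (φ := fun t => t + r) (continuous_value a)
    fun s t h => add_le_add_left h r

theorem minVal_smul (K : NonemptyCompacts (YosidaSpace A)) (a : A) {r : ℝ} (hr : 0 ≤ r) :
    minVal K (r • a) = r * minVal K a := by
  rw [minVal, funext fun M : YosidaSpace A => M.value_smul r a]
  exact minOn_comp_of_monotone (φ := fun t => r * t) (continuous_value a)
    fun s t h => mul_le_mul_of_nonneg_left h hr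

theorem abs_minVal_le (K : NonemptyCompacts (YosidaSpace A)) (a : A) :
    |minVal K a| ≤ balNorm a := by
  obtain ⟨M, -, e⟩ := exists_eq_minOn K (continuous_value a)
  rw [minVal, e]
  exact M.abs_value_le a

theorem minVal_map {B : Type*} [CommRing B] [Lattice B] [Algebra ℝ B] [IsBal B] (f : BalHom A B)
    (K : NonemptyCompacts (YosidaSpace B)) (a : A) :
    minVal (K.map (map f) (map f).continuous) a = minVal K (f a) := by
  rw [minVal, minOn_map]
  simp only [value_map]
  rfl

/-- A real-valued function on `A` that satisfies the defining relations of `H*(A)` is the minimum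
over a nonempty closed subset of the Yosida space. -/
theorem exists_minVal_eq {g : A → ℝ} (hinf : ∀ a b, g (a ⊓ b) = g a ⊓ g b)
    (hpos : ∀ a, g (a ⊔ 0) = g a ⊔ 0) (hadd : ∀ (a : A) (r : ℝ), g (a + r • 1) = g a + r)
    (hsmul : ∀ (a : A) (r : ℝ), 0 ≤ r → g (r • a) = r * g a) :
    ∃ K : NonemptyCompacts (YosidaSpace A), ∀ a, minVal K a = g a := by
  have hmono : ∀ {a b : A}, a ≤ b → g a ≤ g b := fun {a b} h => by
    have := hinf a b
    rw [inf_eq_left.2 h] at this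
    exact inf_eq_left.1 this.symm
  have hzero : g 0 = 0 := by simpa using hsmul 0 0 le_rfl
  -- two elements on which `g` vanishes cannot be separated
  have key : ∀ a b : A, g a = 0 → g b = 0 →
      ∃ M : YosidaSpace A, M.value a ≤ 0 ∧ 0 ≤ M.value b := by
    intro a b ha hb
    by_contra hcon
    push Not at hcon
    have hc : Continuous fun M : YosidaSpace A => M.value (a ⊔ -b) := continuous_value _
    have hpos' : ∀ M : YosidaSpace A, 0 < M.value (a ⊔ -b) := fun M => by
      rw [value_sup, value_neg, lt_sup_iff]
      rcases lt_or_ge 0 (M.value a) with h | h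
      · exact Or.inl h
      · exact Or.inr (neg_pos.2 (hcon M h))
    obtain ⟨ε, hε, hle⟩ : ∃ ε : ℝ, 0 < ε ∧ ∀ M : YosidaSpace A, ε ≤ M.value (a ⊔ -b) := by
      -- On an empty space any positive `ε` serves. The contradiction below covers this case too, so
      -- `key` also shows that the Yosida space has a point.
      rcases isEmpty_or_nonempty (YosidaSpace A) with h | h
      · exact ⟨1, one_pos, fun M => isEmptyElim M⟩
      · obtain ⟨M, -, hM⟩ := isCompact_univ.exists_isMinOn Set.univ_nonempty hc.continuousOn
        exact ⟨_, hpos' M, fun N => hM (Set.mem_univ N)⟩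
    -- At each point either `a ≥ ε`, and then `(|t| / ε) a⁺ ≥ |t| ≥ b + ε`, or `-b ≥ ε`, and then `b
    -- + ε ≤ 0`. So `b + ε ≤ (|t| / ε) a⁺` in `A`, and applying `g` gives the absurd `ε ≤ 0`.
    obtain ⟨t, -, ht⟩ := exists_le_smul_one (b + ε • 1)
    have h1 : b + ε • 1 ≤ (|t| / ε) • (a ⊔ 0) := le_of_value fun M => by
      have h2 := hle M
      have h3 := M.value_mono ht
      rw [value_smul_one] at h3
      rw [value_smul, value_pos]
      rw [value_sup, value_neg] at h2
      rcases le_sup_iff.1 h2 with h | h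
      · calc M.value (b + ε • 1) ≤ |t| := h3.trans (le_abs_self t)
          _ = |t| / ε * ε := by field_simp
          _ ≤ _ := mul_le_mul_of_nonneg_left (h.trans le_sup_left) (by positivity)
      · refine le_trans ?_ (mul_nonneg (by positivity) le_sup_right)
        rw [value_add, value_smul_one]; linarith
    have h4 := hmono h1
    rw [hadd, hb, hsmul _ _ (by positivity), hpos, ha] at h4
    simp at h4
    linarith
  have hshift : ∀ a : A, g (a + (-g a) • 1) = 0 := fun a => by rw [hadd]; ring
  -- each value `g a` is attained on the closed set `{M | ∀ b, g b ≤ M.value b}`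
  have hatt : ∀ a : A, ∃ M : YosidaSpace A, (∀ b, g b ≤ M.value b) ∧ M.value a ≤ g a := by
    intro a
    have hcl : ∀ b : {b : A // g b = 0},
        IsClosed {M : YosidaSpace A | M.value (a + (-g a) • 1) ≤ 0 ∧ 0 ≤ M.value b.1} := fun b =>
      (isClosed_le (continuous_value _) continuous_const).inter
        (isClosed_le continuous_const (continuous_value _))
    have : Nonempty {b : A // g b = 0} := ⟨⟨0, hzero⟩⟩
    -- The sets are nonempty by `key`. They are directed because `g` preserves meets: if `g`
    -- vanishes at `b` and `c`, it vanishes at `b ⊓ c`, whose set lies inside both. Compactness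
    -- gives a common point.
    obtain ⟨M, hM⟩ := IsCompact.nonempty_iInter_of_directed_nonempty_isCompact_isClosed
      (fun b : {b : A // g b = 0} =>
        {M : YosidaSpace A | M.value (a + (-g a) • 1) ≤ 0 ∧ 0 ≤ M.value b.1})
      (by
        rintro ⟨b, hb⟩ ⟨c, hc⟩
        refine ⟨⟨b ⊓ c, by rw [hinf, hb, hc, inf_idem]⟩, ?_, ?_⟩
        · rintro M ⟨h1, h2⟩
          exact ⟨h1, h2.trans (M.value_mono inf_le_left)⟩
        · rintro M ⟨h1, h2⟩
          exact ⟨h1, h2.trans (M.value_mono inf_le_right)⟩)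
      (fun b => key _ b.1 (hshift a) b.2) (fun b => (hcl b).isCompact) hcl
    rw [Set.mem_iInter] at hM
    refine ⟨M, fun b => ?_, ?_⟩
    -- Nonnegativity of the normalized element `b - g b` at `M` is the inequality `g b ≤ b(M)`.
    · have := (hM ⟨b + (-g b) • 1, hshift b⟩).2
      rw [value_add, value_smul_one] at this
      linarith
    · have := (hM ⟨0, hzero⟩).1
      rw [value_add, value_smul_one] at this
      linarith
  have hclosed : IsClosed {M : YosidaSpace A | ∀ b, g b ≤ M.value b} := by
    rw [Set.ofPred_forall]
    exact isClosed_iInter fun b => isClosed_le continuous_const (continuous_value b)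
  -- Attainment at any one element shows that the closed set is nonempty.
  obtain ⟨M₀, hM₀, -⟩ := hatt 0
  let K : NonemptyCompacts (YosidaSpace A) := ⟨⟨_, hclosed.isCompact⟩, ⟨M₀, hM₀⟩⟩
  have hK : ∀ N : YosidaSpace A, N ∈ K ↔ ∀ b, g b ≤ N.value b := fun _ => Iff.rfl
  refine ⟨K, fun a => ?_⟩
  obtain ⟨M, hM, hMa⟩ := hatt a
  exact le_antisymm ((minOn_le (continuous_value a) ((hK M).2 hM)).trans hMa)
    (le_minOn (continuous_value a) fun N hN => (hK N).1 hN a)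

/-! ### The Yosida representation -/

/-- The Yosida representation `A → C(Y(A))`. -/
noncomputable def toCont (A : Type*) [CommRing A] [Lattice A] [Algebra ℝ A] [IsBal A] :
    BalHom A C(YosidaSpace A, ℝ) where
  toAlgHom := AlgHom.ofLinearMap
    { toFun := fun a => ⟨fun M => M.value a, continuous_value a⟩
      map_add' := fun a b => ContinuousMap.ext fun M => M.value_add a b
      map_smul' := fun r a => ContinuousMap.ext fun M => M.value_smul r a }
    (ContinuousMap.ext fun M => by simpa using M.value_smul_one 1)
    (fun a b => ContinuousMap.ext fun M => M.value_mul a b)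
  map_sup' a b := ContinuousMap.ext fun M => M.value_sup a b
  map_inf' a b := ContinuousMap.ext fun M => M.value_inf a b

theorem toCont_injective : Function.Injective (toCont A) := fun _ _ h =>
  ext_of_value fun M => DFunLike.congr_fun h M

theorem balNorm_le {a : A} {r : ℝ} (hr : 0 ≤ r) (h : |a| ≤ r • (1 : A)) : balNorm a ≤ r := by
  rcases subsingleton_or_nontrivial A with hA | hA
  -- In the zero ring every real number is a bound, and `sInf` of all of `ℝ` is `0` by default.
  · simpa [balNorm] using hr
  · exact csInf_le ⟨0, fun r hr => nonneg_of_abs_le hr⟩ h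

/-- Order is pointwise on the Yosida space, so a scalar bounds `|a|` exactly when it bounds all
values. Completeness for `balNorm` thus becomes completeness for the sup norm. -/
theorem balNorm_eq_norm_toCont (a : A) : balNorm a = ‖toCont A a‖ := by
  refine le_antisymm (balNorm_le (norm_nonneg _) (le_of_value fun M => ?_)) ?_
  · rw [value_abs, value_smul_one]
    exact (toCont A a).norm_coe_le_norm M
  · exact (ContinuousMap.norm_le _ (balNorm_nonneg a)).2 fun M => M.abs_value_le a

theorem separatesPoints_range_toCont : (toCont A).toAlgHom.range.SeparatesPoints := by
  intro M N hMN
  obtain ⟨a, haM, haN⟩ := exists_separating hMN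
  refine ⟨_, ⟨toCont A a, ⟨a, rfl⟩, rfl⟩, fun h => haN (value_eq_zero.1 ?_)⟩
  exact h.symm.trans (value_eq_zero.2 haM)

/-- The image separates points, so Stone–Weierstrass approximates `f` by elements of the image. The
approximants are Cauchy in `A` because the embedding is isometric, and the image of their limit is
`f`. -/
theorem toCont_surjective (hA : UniformlyComplete A) : Function.Surjective (toCont A) := by
  intro f
  have happrox : ∀ n : ℕ, ∃ a : A, ‖toCont A a - f‖ < 1 / ((n : ℝ) + 1) := fun n => by
    obtain ⟨⟨_, a, rfl⟩, h⟩ :=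
      ContinuousMap.exists_mem_subalgebra_near_continuousMap_of_separatesPoints _
        separatesPoints_range_toCont f _ (Nat.one_div_pos_of_nat (α := ℝ) (n := n))
    exact ⟨a, h⟩
  choose s hs using happrox
  have hlim : Filter.Tendsto (fun n => toCont A (s n)) Filter.atTop (nhds f) :=
    tendsto_iff_norm_sub_tendsto_zero.2 (squeeze_zero (fun _ => norm_nonneg _)
      (fun n => (hs n).le) tendsto_one_div_add_atTop_nhds_zero_nat)
  obtain ⟨a, ha⟩ := hA s fun ε hε => by
    obtain ⟨N, hN⟩ := Metric.cauchySeq_iff.1 hlim.cauchySeq ε hε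
    refine ⟨N, fun m hm n hn => ?_⟩
    rw [balNorm_eq_norm_toCont, map_sub, ← dist_eq_norm]
    exact hN m hm n hn
  refine ⟨a, tendsto_nhds_unique (Metric.tendsto_atTop.2 fun ε hε => ?_) hlim⟩
  obtain ⟨N, hN⟩ := ha ε hε
  refine ⟨N, fun n hn => ?_⟩
  rw [dist_eq_norm, ← map_sub, ← balNorm_eq_norm_toCont]
  exact hN n hn

end

/-! ### Recovering a compact Hausdorff space from its continuous functions -/

section Cont

variable {X : Type u} [TopologicalSpace X] [CompactSpace X]

theorem balNorm_eq_norm (f : C(X, ℝ)) : balNorm f = ‖f‖ := by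
  refine le_antisymm (balNorm_le (norm_nonneg f) fun x => ?_) ?_
  · simpa using f.norm_coe_le_norm x
  · refine (ContinuousMap.norm_le _ (balNorm_nonneg f)).2 fun x => ?_
    obtain ⟨t, -, ht⟩ := exists_le_smul_one |f|
    refine le_csInf ⟨t, ht⟩ fun r hr => ?_
    have h1 : |f| x ≤ (r • (1 : C(X, ℝ))) x := hr x
    simpa using h1

theorem uniformlyComplete_cont : UniformlyComplete C(X, ℝ) := by
  intro s hs
  have hc : CauchySeq s := Metric.cauchySeq_iff.2 fun ε hε => by
    obtain ⟨N, hN⟩ := hs ε hε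
    refine ⟨N, fun m hm n hn => ?_⟩
    rw [dist_eq_norm, ← balNorm_eq_norm]
    exact hN m hm n hn
  obtain ⟨f, hf⟩ := cauchySeq_tendsto_of_complete hc
  refine ⟨f, fun ε hε => ?_⟩
  obtain ⟨N, hN⟩ := Metric.tendsto_atTop.1 hf ε hε
  refine ⟨N, fun n hn => ?_⟩
  rw [balNorm_eq_norm, ← dist_eq_norm]
  exact hN n hn

/-- Evaluation at a point of `X`. -/
def evalAt (x : X) : BalHom C(X, ℝ) ℝ where
  toAlgHom := ContinuousMap.evalAlgHom ℝ ℝ x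
  map_sup' _ _ := rfl
  map_inf' _ _ := rfl

/-- The canonical map `X → Y(C(X))`. -/
def ofPoint (X : Type u) [TopologicalSpace X] [CompactSpace X] : C(X, YosidaSpace C(X, ℝ)) where
  toFun x := ofHom (evalAt x)
  continuous_toFun := continuous_of_value fun f => by
    simp only [value_ofHom]
    exact f.continuous

theorem value_ofPoint (x : X) (f : C(X, ℝ)) : (ofPoint X x).value f = f x := value_ofHom _ f

theorem ofPoint_injective [T2Space X] : Function.Injective (ofPoint X) := by
  intro x y h
  by_contra hxy
  obtain ⟨f, hf0, hf1, -⟩ := exists_continuous_zero_one_of_isClosed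
    (isClosed_singleton (x := x)) (isClosed_singleton (x := y))
    (Set.disjoint_singleton.2 hxy)
  have h1 := value_ofPoint x f
  rw [h, value_ofPoint, hf0 rfl, hf1 rfl] at h1
  exact one_ne_zero h1

/-- If `M` is not a point evaluation, each `x` has some `f ∈ M` with `f x ≠ 0`. By compactness a
finite sum of absolute values of such functions is strictly positive, so `M` contains a unit. -/
theorem ofPoint_surjective [T2Space X] : Function.Surjective (ofPoint X) := by
  intro M
  by_contra hcon
  push Not at hcon
  have hsep : ∀ x : X, ∃ f ∈ M.1, f x ≠ 0 := fun x => by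
    obtain ⟨f, hfM, hf⟩ := exists_separating (hcon x).symm
    exact ⟨f, hfM, fun h => hf (value_eq_zero.1 ((value_ofPoint x f).trans h))⟩
  choose f hfM hfx using hsep
  obtain ⟨t, ht⟩ := isCompact_univ.elim_finite_subcover (fun x => {y | f x y ≠ 0})
    (fun x => (isClosed_eq (f x).continuous continuous_const).isOpen_compl)
    (fun x _ => Set.mem_iUnion.2 ⟨x, hfx x⟩)
  let g : C(X, ℝ) := ∑ x ∈ t, |f x|
  have hgM : g ∈ M.1 := M.1.ideal.sum_mem fun x _ => LIdeal.abs_mem.2 (hfM x)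
  have hgpos : ∀ y, 0 < g y := fun y => by
    obtain ⟨x, hx, hxy⟩ := Set.mem_iUnion₂.1 (ht (Set.mem_univ y))
    have e : g y = ∑ x ∈ t, |f x y| := by simp [g, ContinuousMap.sum_apply]
    rw [e]
    exact Finset.sum_pos' (fun _ _ => abs_nonneg _) ⟨x, hx, abs_pos.2 hxy⟩
  let k : C(X, ℝ) := ⟨fun y => (g y)⁻¹, g.continuous.inv₀ fun y => (hgpos y).ne'⟩
  refine LIdeal.one_notMem M.2 ?_
  have e : k * g = 1 := ContinuousMap.ext fun y => inv_mul_cancel₀ (hgpos y).ne'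
  exact e ▸ M.1.mul_mem k hgM

end Cont

end YosidaSpace

open YosidaSpace

/-! ### The Yosida space of `H*(A)` -/

/-- Evaluation of the elements of a free algebra at a point. -/
def FreeBal.evalAt {X : Type u} {w : X → ℝ≥0} (p : WeightBox w) : BalHom (FreeBal w) ℝ where
  toAlgHom := AlgHom.ofLinearMap
    { toFun := fun f => f.1 p
      map_add' := fun _ _ => rfl
      map_smul' := fun _ _ => rfl } rfl fun _ _ => rfl
  map_sup' _ _ := rfl
  map_inf' _ _ := rfl

/-- The target may lie in any universe, unlike in `hStar_hom_ext`; the case needed is `ℝ`. -/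
theorem hStar_hom_ext' {A : Bal.{u}} {B : Type v} [CommRing B] [Lattice B] [Algebra ℝ B] [IsBal B]
    {φ ψ : BalHom (hStarObj A) B} (h : ∀ a, φ (boxStar A a) = ψ (boxStar A a)) : φ = ψ := by
  have key : φ.comp (starIdeal A).mkHom = ψ.comp (starIdeal A).mkHom := FreeBal.hom_ext h
  refine BalHom.hom_ext fun x => ?_
  obtain ⟨y, rfl⟩ := (starIdeal A).mk_surjective x
  exact DFunLike.congr_fun key y

theorem hStar_point_ext {A : Bal.{u}} {M N : YosidaSpace (hStarObj A)}
    (h : ∀ a, M.value (boxStar A a) = N.value (boxStar A a)) : M = N := by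
  have : M.evalHom = N.evalHom := hStar_hom_ext' h
  exact ext_value fun x => DFunLike.congr_fun this x

section Relations

variable (A : Bal.{u})

/-- This relation and the next three are exactly the hypotheses of `exists_minVal_eq` for `a ↦
M.value (boxStar A a)`. -/
theorem boxStar_inf (a b : A) : boxStar A (a ⊓ b) = boxStar A a ⊓ boxStar A b :=
  LIdeal.mk_eq_mk.2 (LIdeal.subset_archGen _ (StarRel.inf a b))

theorem boxStar_pos (a : A) : boxStar A (a ⊔ 0) = boxStar A a ⊔ 0 :=
  LIdeal.mk_eq_mk.2 (LIdeal.subset_archGen _ (StarRel.pos a))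

theorem boxStar_add (a : A) (r : ℝ) : boxStar A (a + r • 1) = boxStar A a + r • 1 :=
  (LIdeal.mk_eq_mk (a := freeOf A (a + r • 1)) (b := freeOf A a + r • 1)).2 (by
    rw [← sub_sub]; exact LIdeal.subset_archGen _ (StarRel.add a r))

theorem boxStar_smul (a : A) {r : ℝ} (hr : 0 ≤ r) : boxStar A (r • a) = r • boxStar A a :=
  LIdeal.mk_eq_mk.2 (LIdeal.subset_archGen _ (StarRel.smul a r hr))

end Relations

/-- The point `a ↦ min_K a` of the weight box of `A`. -/
noncomputable def minPoint {A : Bal.{u}} (K : NonemptyCompacts (YosidaSpace A)) :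
    WeightBox (boxWeight A) :=
  ⟨minVal K, fun a => (abs_minVal_le K a).trans (by rw [coe_boxWeight]; exact le_max_left _ _)⟩

/-- The real-valued morphism on `H*(A)` with `□*_a ↦ min_K a`. -/
noncomputable def minHom {A : Bal.{u}} (K : NonemptyCompacts (YosidaSpace A)) :
    BalHom (hStarObj A) ℝ :=
  LIdeal.quotLift {x | StarRel A x} (FreeBal.evalAt (minPoint K)) (by
    rintro _ (⟨a, b⟩ | a | ⟨a, r⟩ | ⟨a, r, hr⟩)
    · exact sub_eq_zero.2 (minVal_inf K a b)
    · exact sub_eq_zero.2 (minVal_pos K a)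
    · change minVal K (a + r • 1) - minVal K a - r * 1 = 0
      rw [minVal_add]; ring
    · exact sub_eq_zero.2 (minVal_smul K a hr))

theorem minHom_boxStar {A : Bal.{u}} (K : NonemptyCompacts (YosidaSpace A)) (a : A) :
    minHom K (boxStar A a) = minVal K a := rfl

/-- The point of `Y(H*(A))` given by a nonempty closed subset of `Y(A)`. -/
noncomputable def vietorisPoint {A : Bal.{u}} (K : NonemptyCompacts (YosidaSpace A)) :
    YosidaSpace (hStarObj A) := ofHom (minHom K)

theorem value_vietorisPoint {A : Bal.{u}} (K : NonemptyCompacts (YosidaSpace A)) (a : A) :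
    (vietorisPoint K).value (boxStar A a) = minVal K a :=
  (value_ofHom _ _).trans (minHom_boxStar K a)

/-- A representative in the free algebra is built from coordinates and constants by ring and lattice
operations. By induction only the coordinates matter, and for these the claim is `continuous_minOn`.
-/
theorem continuous_vietorisPoint (A : Bal.{u}) :
    Continuous (vietorisPoint : NonemptyCompacts (YosidaSpace A) → YosidaSpace (hStarObj A)) := by
  refine continuous_of_value fun x => ?_
  obtain ⟨⟨f, hf⟩, rfl⟩ := (starIdeal A).mk_surjective x
  have e : (fun K : NonemptyCompacts (YosidaSpace A) =>
      (vietorisPoint K).value ((starIdeal A).proj ⟨f, hf⟩)) = fun K => f (minPoint K) :=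
    funext fun K => value_ofHom (minHom K) _
  refine e ▸ ?_
  clear e
  induction hf with
  | coord a => exact continuous_minOn (continuous_value a)
  | const r => exact continuous_const
  | add _ _ hf hg => exact hf.add hg
  | mul _ _ hf hg => exact hf.mul hg
  | sup _ _ hf hg => exact hf.sup hg
  | inf _ _ hf hg => exact hf.inf hg

theorem vietorisPoint_injective (A : Bal.{u}) :
    Function.Injective
      (vietorisPoint : NonemptyCompacts (YosidaSpace A) → YosidaSpace (hStarObj A)) :=
  fun K L h => ext_minVal fun a => by rw [← value_vietorisPoint, h, value_vietorisPoint]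

/-- A point of `Y(H*(A))` is determined by its values on the elements `□a`, and `exists_minVal_eq`
realizes those values as minima. -/
theorem vietorisPoint_surjective (A : Bal.{u}) :
    Function.Surjective
      (vietorisPoint : NonemptyCompacts (YosidaSpace A) → YosidaSpace (hStarObj A)) := by
  intro M
  obtain ⟨K, hK⟩ := exists_minVal_eq (g := fun a => M.value (boxStar A a))
    (fun a b => by rw [boxStar_inf, value_inf])
    (fun a => by rw [boxStar_pos, value_pos])
    (fun a r => by rw [boxStar_add, value_add, value_smul_one])
    (fun a r hr => by rw [boxStar_smul A a hr, value_smul])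
  exact ⟨K, hStar_point_ext fun a => (value_vietorisPoint K a).trans (hK a)⟩

/-- The homeomorphism `V*(Y(A)) ≃ Y(H*(A))`. -/
noncomputable def vietorisHomeo (A : Bal.{u}) :
    NonemptyCompacts (YosidaSpace A) ≃ₜ YosidaSpace (hStarObj A) :=
  (continuous_vietorisPoint A).homeoOfEquivCompactToT2
    (f := Equiv.ofBijective _ ⟨vietorisPoint_injective A, vietorisPoint_surjective A⟩)

theorem value_vietorisHomeo {A : Bal.{u}} (K : NonemptyCompacts (YosidaSpace A)) (a : A) :
    (vietorisHomeo A K).value (boxStar A a) = minVal K a := value_vietorisPoint K a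

theorem minVal_vietorisHomeo_symm {A : Bal.{u}} (M : YosidaSpace (hStarObj A)) (a : A) :
    minVal ((vietorisHomeo A).symm M) a = M.value (boxStar A a) := by
  rw [← value_vietorisHomeo, Homeomorph.apply_symm_apply]

/-! ### The dual adjunction between algebras and compact Hausdorff spaces -/

/-- The morphism of `ℓ`-algebras underlying a morphism of the category `Bal`. -/
def Bal.hom {A B : Bal.{u}} (f : A ⟶ B) : BalHom A B := f

/-- The inverse algebra isomorphism preserves joins and meets because the forward map does and is
injective. -/
theorem Bal.isIso_of_bijective {A B : Bal.{u}} (f : A ⟶ B)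
    (hf : Function.Bijective (Bal.hom f)) : IsIso f := by
  let e : A ≃ₐ[ℝ] B := AlgEquiv.ofBijective (Bal.hom f).toAlgHom hf
  have he : ∀ a, e a = Bal.hom f a := fun _ => rfl
  let g : BalHom B A :=
    { toAlgHom := e.symm
      map_sup' := fun a b => e.injective (by
        change e (e.symm (a ⊔ b)) = Bal.hom f (e.symm a ⊔ e.symm b)
        rw [map_sup (Bal.hom f), ← he, ← he]
        simp only [AlgEquiv.apply_symm_apply])
      map_inf' := fun a b => e.injective (by
        change e (e.symm (a ⊓ b)) = Bal.hom f (e.symm a ⊓ e.symm b)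
        rw [map_inf (Bal.hom f), ← he, ← he]
        simp only [AlgEquiv.apply_symm_apply]) }
  exact ⟨g, BalHom.hom_ext fun a => e.symm_apply_apply a,
    BalHom.hom_ext fun b => e.apply_symm_apply b⟩

/-- The algebra `C(X)` as an object of `Bal`. -/
abbrev contObj (X : CompHaus.{u}) : Bal.{u} := { carrier := C(X, ℝ) }

/-- The morphism `C(Y) → C(X)` given by composition with a continuous map `X → Y`. -/
def pullback {X Y : Type u} [TopologicalSpace X] [CompactSpace X] [TopologicalSpace Y]
    [CompactSpace Y] (φ : C(X, Y)) : BalHom C(Y, ℝ) C(X, ℝ) where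
  toAlgHom := ContinuousMap.compRightAlgHom ℝ ℝ φ
  map_sup' _ _ := rfl
  map_inf' _ _ := rfl

theorem pullback_apply {X Y : Type u} [TopologicalSpace X] [CompactSpace X] [TopologicalSpace Y]
    [CompactSpace Y] (φ : C(X, Y)) (f : C(Y, ℝ)) (x : X) : pullback φ f x = f (φ x) := rfl

/-- The Yosida representation as a morphism. -/
noncomputable def yosidaUnit (A : Bal.{u}) :
    A ⟶ contFunctor.obj (yosidaFunctor.obj A) := toCont A

/-- The canonical map `X → Y(C(X))` as a morphism. -/
def yosidaCounit (X : CompHaus.{u}) : X ⟶ (yosidaFunctor.obj (contFunctor.obj (.op X))).unop :=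
  CompHausLike.ofHom _ (ofPoint X)

theorem isIso_yosidaUnit {A : Bal.{u}} (hA : UniformlyComplete A) : IsIso (yosidaUnit A) :=
  Bal.isIso_of_bijective _ ⟨toCont_injective, toCont_surjective hA⟩

theorem isIso_yosidaCounit (X : CompHaus.{u}) : IsIso (yosidaCounit X) :=
  CompHausLike.isIso_of_bijective _ ⟨ofPoint_injective, ofPoint_surjective⟩

/-! ### The functors between algebras and coalgebras -/

/-- The structure morphism of an algebra for `H*`. -/
def algHom (A : AlgHStar.{u}) : BalHom (hStarObj A.a) A.a := A.str

/-- The structure map of a coalgebra for `V*`. -/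
noncomputable def coalgMap (X : CoalgVStar.{u}) : C(X.V, NonemptyCompacts X.V) := X.str.hom.hom

/-- The coalgebra structure on `Y(A)` for an algebra `(A, α)`. -/
noncomputable def coalgStr (A : AlgHStar.{u}) :
    C(YosidaSpace A.a, NonemptyCompacts (YosidaSpace A.a)) :=
  ContinuousMap.comp ⟨(vietorisHomeo A.a).symm, (vietorisHomeo A.a).symm.continuous⟩
    (YosidaSpace.map (algHom A))

/-- This characterizes the coalgebra structure, since closed sets are determined by their minima.
The later squares use it in place of the inverse homeomorphism. -/
theorem minVal_coalgStr (A : AlgHStar.{u}) (M : YosidaSpace A.a) (a : A.a) :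
    minVal (coalgStr A M) a = M.value (algHom A (boxStar A.a a)) :=
  (minVal_vietorisHomeo_symm _ a).trans (value_map _ _ _)

theorem algHom_boxStar {A B : AlgHStar.{u}} (f : A ⟶ B) (a : A.a) :
    algHom B (boxStar B.a (Bal.hom f.f a)) = Bal.hom f.f (algHom A (boxStar A.a a)) := by
  rw [← hStarMap_boxStar]
  exact DFunLike.congr_fun (F := BalHom (hStarObj A.a) B.a) f.h (boxStar A.a a)

/-- Both closed sets have the same minima: on the elements `□a`, the condition that `f` is a
morphism of algebras turns one minimum into the other. -/
theorem coalgStr_map {A B : AlgHStar.{u}} (f : A ⟶ B) (M : YosidaSpace B.a) :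
    (coalgStr B M).map (YosidaSpace.map (Bal.hom f.f)) (YosidaSpace.map (Bal.hom f.f)).continuous =
      coalgStr A (YosidaSpace.map (Bal.hom f.f) M) :=
  ext_minVal fun a => by
    rw [minVal_map, minVal_coalgStr, minVal_coalgStr, value_map, algHom_boxStar]

/-- The lift of the functor `Y` to algebras for `H*`. -/
noncomputable def algToCoalg : AlgHStar.{u} ⥤ CoalgVStar.{u}ᵒᵖ where
  obj A := .op
    { V := CompHaus.of (YosidaSpace A.a)
      str := CompHausLike.ofHom _ (coalgStr A) }
  map f := Quiver.Hom.op
    { f := CompHausLike.ofHom _ (YosidaSpace.map (Bal.hom f.f))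
      h := ConcreteCategory.hom_ext _ _ fun M => coalgStr_map f M }
  map_id _ := rfl
  map_comp _ _ := rfl

theorem minVal_map_ofPoint {X : Type u} [TopologicalSpace X] [CompactSpace X]
    (K : NonemptyCompacts X) (f : C(X, ℝ)) :
    minVal (K.map (ofPoint X) (ofPoint X).continuous) f = minOn K f := by
  rw [minVal, minOn_map]
  simp only [value_ofPoint]

/-- The continuous map `V*(X) → V*(Y(C(X)))` that sends `K` to its image. -/
def mapOfPoint (X : Type u) [TopologicalSpace X] [CompactSpace X] :
    C(NonemptyCompacts X, NonemptyCompacts (YosidaSpace C(X, ℝ))) :=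
  ⟨fun K => K.map (ofPoint X) (ofPoint X).continuous,
    (ofPoint X).continuous.nonemptyCompacts_map⟩

/-- The algebra structure on `C(X)` for a coalgebra `(X, σ)`. -/
noncomputable def algStr (X : CoalgVStar.{u}) : BalHom (hStarObj (contObj X.V)) C(X.V, ℝ) :=
  BalHom.comp
    (pullback (((⟨vietorisHomeo (contObj X.V), (vietorisHomeo (contObj X.V)).continuous⟩ :
      C(NonemptyCompacts (YosidaSpace (contObj X.V)), _)).comp
        (mapOfPoint X.V)).comp (coalgMap X)))
    (toCont (hStarObj (contObj X.V)))

/-- The counterpart of `minVal_coalgStr`: the homeomorphism turns `□f` into `K ↦ min_K f`, which is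
then evaluated at the image of `σ(x)` in `Y(C(X))`. -/
theorem algStr_boxStar (X : CoalgVStar.{u}) (f : C(X.V, ℝ)) (x : X.V) :
    algStr X (boxStar (contObj X.V) f) x = minOn (coalgMap X x) f :=
  (value_vietorisHomeo (A := contObj X.V) _ f).trans (minVal_map_ofPoint _ f)

theorem coalgMap_apply {X Y : CoalgVStar.{u}} (φ : X ⟶ Y) (x : X.V) :
    coalgMap Y (φ.f.hom.hom x) = (coalgMap X x).map φ.f.hom.hom φ.f.hom.hom.continuous :=
  (ConcreteCategory.congr_hom φ.h x).symm

/-- At `x` both sides are the minimum of `f` over `φ(σ(x)) = σ(φ x)`. -/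
theorem algStr_pullback {X Y : CoalgVStar.{u}} (φ : X ⟶ Y) (f : C(Y.V, ℝ)) :
    algStr X (boxStar (contObj X.V) (pullback φ.f.hom.hom f)) =
      pullback φ.f.hom.hom (algStr Y (boxStar (contObj Y.V) f)) :=
  ContinuousMap.ext fun x => by
    rw [pullback_apply, algStr_boxStar, algStr_boxStar, coalgMap_apply, minOn_map]
    rfl

/-- The lift of the functor `C` to coalgebras for `V*`. -/
noncomputable def coalgToAlg : CoalgVStar.{u}ᵒᵖ ⥤ AlgHStar.{u} where
  obj X :=
    { a := contFunctor.obj (.op X.unop.V)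
      str := algStr X.unop }
  map {X Y} φ :=
    { f := contFunctor.map (Quiver.Hom.op φ.unop.f)
      h := hStar_hom_ext (A := contObj X.unop.V) (B := contObj Y.unop.V) fun f =>
        (congrArg (algStr Y.unop) (hStarMap_boxStar (A := contObj X.unop.V)
          (B := contObj Y.unop.V) (pullback φ.unop.f.hom.hom) f)).trans
          (algStr_pullback φ.unop f) }
  map_id _ := rfl
  map_comp _ _ := rfl

theorem algStr_toCont (A : AlgHStar.{u}) (a : A.a) :
    algStr (algToCoalg.obj A).unop (boxStar (contObj (algToCoalg.obj A).unop.V) (toCont A.a a)) =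
      toCont A.a (algHom A (boxStar A.a a)) :=
  ContinuousMap.ext fun M =>
    (algStr_boxStar (algToCoalg.obj A).unop (toCont A.a a) M).trans (minVal_coalgStr A M a)

/-- The unit of the adjunction. -/
noncomputable def algUnit (A : AlgHStar.{u}) : A ⟶ coalgToAlg.obj (algToCoalg.obj A) where
  f := yosidaUnit A.a
  h := hStar_hom_ext (B := contObj (algToCoalg.obj A).unop.V) fun a =>
    (congrArg (algStr (algToCoalg.obj A).unop) (hStarMap_boxStar
      (B := contObj (algToCoalg.obj A).unop.V) (toCont A.a) a)).trans (algStr_toCont A a)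

/-- Both closed sets have as minimum of `f` the value at `x` of the algebra structure on `□f`. This
makes the Yosida counit a coalgebra morphism. -/
theorem map_ofPoint_coalgMap (X : CoalgVStar.{u}) (x : X.V) :
    (coalgMap X x).map (ofPoint X.V) (ofPoint X.V).continuous =
      coalgStr (coalgToAlg.obj (.op X)) (ofPoint X.V x) :=
  ext_minVal fun f => (minVal_map_ofPoint _ f).trans <| (algStr_boxStar X f x).symm.trans <|
    (value_ofPoint x _).symm.trans (minVal_coalgStr (coalgToAlg.obj (.op X)) _ f).symm

/-- The counit of the adjunction. -/
noncomputable def coalgCounit (X : CoalgVStar.{u}) :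
    X ⟶ (algToCoalg.obj (coalgToAlg.obj (.op X))).unop where
  f := yosidaCounit X.V
  h := ConcreteCategory.hom_ext _ _ fun x => map_ofPoint_coalgMap X x

/-! ### The adjunction and the equivalence -/

theorem ofPoint_natural {X Y : Type u} [TopologicalSpace X] [CompactSpace X]
    [TopologicalSpace Y] [CompactSpace Y] (φ : C(X, Y)) (x : X) :
    YosidaSpace.map (pullback φ) (ofPoint X x) = ofPoint Y (φ x) :=
  ext_value fun f => by rw [value_map, value_ofPoint, value_ofPoint, pullback_apply]

theorem toCont_natural {A B : Type u} [CommRing A] [Lattice A] [Algebra ℝ A] [IsBal A]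
    [CommRing B] [Lattice B] [Algebra ℝ B] [IsBal B] (f : BalHom A B) (a : A) :
    toCont B (f a) = pullback (YosidaSpace.map f) (toCont A a) :=
  ContinuousMap.ext fun M => (value_map f M a).symm

theorem map_toCont_ofPoint {A : Type u} [CommRing A] [Lattice A] [Algebra ℝ A] [IsBal A]
    (M : YosidaSpace A) : YosidaSpace.map (toCont A) (ofPoint _ M) = M :=
  ext_value fun a => (value_map _ _ a).trans (value_ofPoint M _)

theorem pullback_ofPoint_toCont {X : Type u} [TopologicalSpace X] [CompactSpace X] (f : C(X, ℝ)) :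
    pullback (ofPoint X) (toCont C(X, ℝ) f) = f :=
  ContinuousMap.ext fun x => value_ofPoint x f

/-- The adjunction between algebras for `H*` and coalgebras for `V*`. -/
noncomputable def algCoalgAdjunction : algToCoalg.{u} ⊣ coalgToAlg.{u} where
  unit :=
    { app := algUnit
      naturality := fun _ _ f => Endofunctor.Algebra.ext <| BalHom.hom_ext fun a =>
        toCont_natural (Bal.hom f.f) a }
  counit :=
    { app := fun X => (coalgCounit X.unop).op
      naturality := fun _ _ φ => Quiver.Hom.unop_inj <| Endofunctor.Coalgebra.ext <|
        ConcreteCategory.hom_ext _ _ fun x => ofPoint_natural φ.unop.f.hom.hom x }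
  left_triangle_components _ := Quiver.Hom.unop_inj <| Endofunctor.Coalgebra.ext <|
    ConcreteCategory.hom_ext _ _ fun M => map_toCont_ofPoint M
  right_triangle_components _ := Endofunctor.Algebra.ext <| BalHom.hom_ext fun f =>
    pullback_ofPoint_toCont f

theorem algUHStar_coalgToAlg (X : CoalgVStar.{u}ᵒᵖ) : AlgUHStar.{u} (coalgToAlg.obj X) :=
  uniformlyComplete_cont (X := X.unop.V)

/-- An algebra morphism with invertible underlying morphism is invertible, so only the Yosida
representation has to be inverted. -/
theorem isIso_unit_app (A : AlgHStar.{u}) (hA : AlgUHStar A) :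
    IsIso (algCoalgAdjunction.unit.app A) :=
  have : IsIso (algCoalgAdjunction.unit.app A).f := isIso_yosidaUnit hA
  Endofunctor.Algebra.iso_of_iso _

theorem isIso_counit_app (X : CoalgVStar.{u}ᵒᵖ) : IsIso (algCoalgAdjunction.counit.app X) :=
  have : IsIso (coalgCounit X.unop).f := isIso_yosidaCounit X.unop.V
  have : IsIso (coalgCounit X.unop) := Endofunctor.Coalgebra.iso_of_iso _
  inferInstanceAs (IsIso (coalgCounit X.unop).op)

/-- The dual equivalence between uniformly complete algebras for `H*` and coalgebras for `V*`. -/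
noncomputable def algUCoalgEquivalence : AlgUHStar.{u}.FullSubcategory ≌ CoalgVStar.{u}ᵒᵖ :=
  have (A : AlgUHStar.{u}.FullSubcategory) : IsIso (algCoalgAdjunction.unit.app A.obj) :=
    isIso_unit_app A.obj A.property
  have := isIso_counit_app.{u}
  -- This constructor may alter one of the two isomorphisms to obtain the triangle identity, but it
  -- keeps both functors, so they can later be identified by `rfl`.
  CategoryTheory.Equivalence.mk (AlgUHStar.ι ⋙ algToCoalg)
    (AlgUHStar.lift coalgToAlg algUHStar_coalgToAlg)
    (NatIso.ofComponents
      (fun A => AlgUHStar.isoMk (asIso (algCoalgAdjunction.unit.app A.obj)))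
      fun f => ObjectProperty.hom_ext _ (algCoalgAdjunction.unit.naturality f.hom))
    (NatIso.ofComponents (fun X => asIso (algCoalgAdjunction.counit.app X))
      fun f => algCoalgAdjunction.counit.naturality f)

end BalDuality

theorem mainTheorem8 :
    ∃ (F : BalDuality.AlgHStar.{u} ⥤ BalDuality.CoalgVStar.{u}ᵒᵖ)
      (G : BalDuality.CoalgVStar.{u}ᵒᵖ ⥤ BalDuality.AlgHStar.{u})
      (adj : F ⊣ G),
      Nonempty (F ⋙ (Endofunctor.Coalgebra.forget BalDuality.VStar.{u}).op ≅
        Endofunctor.Algebra.forget BalDuality.HStar.{u} ⋙ BalDuality.yosidaFunctor.{u}) ∧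
      Nonempty (G ⋙ Endofunctor.Algebra.forget BalDuality.HStar.{u} ≅
        (Endofunctor.Coalgebra.forget BalDuality.VStar.{u}).op ⋙ BalDuality.contFunctor.{u}) ∧
      ∃ (hG : ∀ X, BalDuality.AlgUHStar.{u} (G.obj X))
        (e : BalDuality.AlgUHStar.{u}.FullSubcategory ≌ BalDuality.CoalgVStar.{u}ᵒᵖ),
        e.functor = BalDuality.AlgUHStar.{u}.ι ⋙ F ∧
        e.inverse = BalDuality.AlgUHStar.{u}.lift G hG ∧
        (∀ A, BalDuality.AlgUHStar.{u} A → IsIso (adj.unit.app A)) ∧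
        (∀ X, IsIso (adj.counit.app X)) :=
  ⟨BalDuality.algToCoalg, BalDuality.coalgToAlg, BalDuality.algCoalgAdjunction,
    -- The lifts have `Y` and `C` as underlying functors by definition, so identity isomorphisms
    -- suffice.
    ⟨Iso.refl _⟩, ⟨Iso.refl _⟩, BalDuality.algUHStar_coalgToAlg, BalDuality.algUCoalgEquivalence,
    rfl, rfl, BalDuality.isIso_unit_app, BalDuality.isIso_counit_app⟩
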